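/- Let $G$ be a subgroup of the additive group $\mathbb{Q}$ that is computable, in the sense that it is isomorphic to a structure, in the language of groups $(\cdot,{}^{-1},1)$, whose universe is a set of natural numbers and whose atomic diagram is computable. Fix a nonzero element $u\in G$ (to play the role of $1$), and for $m\in\mathbb{N}$ write $m\mid u$ if $my=u$ for some $y\in G$. Put $$P^0=\{p \text{ prime}: p\nmid u\},$$ $$P^{fin}=\{p\text{ prime}: p^k\mid u \text{ and } p^{k+1}\nmid u\text{ for some }k>0\},$$ $$P^\infty=\{p\text{ prime}: p^k\mid u\text{ for all }k>0\}.$$ Suppose that $P^0$ is infinite, $P^{fin}$ is infinite, and $P^\infty$ is finite. Then: 1. $G$ has a computable $\Sigma_3$ Scott sentence, that is, there is a computable infinitary $\Sigma_3$ sentence $\varphi$ in the language of groups such that the countable models of $\varphi$ are exactly the countable structures isomorphic to $G$; 2. the index set $I(G)=\{e\in\mathbb{N}:\varphi_e=\chi_{D(\mathcal{B})}\text{ for some }\mathcal{B}\cong G\}$ is $m$-complete $\Sigma^0_3$, that is, $I(G)$ is $\Sigma^0_3$ and every $\Sigma^0_3$ set $S\subseteq\mathbb{N}$ is many-one reducible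 to $I(G)$. Here $\varphi_e$ is the $e$-th partial computable function, $W_e$ is its domain, $\mathcal{B}$ ranges over structures with universe a set of natural numbers, and $\chi_{D(\mathcal{B})}$ is the characteristic function of the set of Gödel numbers of the members of the atomic diagram of $\mathcal{B}$ (the atomic sentences and negations of atomic sentences, with constants for the elements, that are true in $\mathcal{B}$). A formula is computable $\Sigma_0$ (and $\Pi_0$) if it is finitary and quantifier-free; for $n>0$ it is computable $\Sigma_n$ (respectively $\Pi_n$) if it is a c.e. disjunction (respectively conjunction) of formulas $(\exists\bar y)\,\psi$ (respectively $(\forall\bar y)\,\psi$) with $\bar y$ a finite tuple of variables and each $\psi$ computable $\Pi_m$ (respectively $\Sigma_m$) for some $m<n$, where c.e. means that the disjuncts or conjuncts are given by indices that form a c.e. set $W_e$. -/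

import Mathlib

namespace ScottQ

open FirstOrder Nat.Partrec

/-! ### The language of groups, its structures and its terms -/

/-- The function symbols of the language of groups: a constant for the identity, a unary symbol
for the inverse and a binary symbol for the group operation. -/
inductive GroupFunc : ℕ → Type
  | one : GroupFunc 0
  | inv : GroupFunc 1
  | mul : GroupFunc 2

/-- The language of groups (no relation symbols besides equality). -/
def groupLang : FirstOrder.Language.{0, 0} := ⟨GroupFunc, fun _ => Empty⟩

/-- A subgroup of the additive group of rationals as a structure for the language of groups. -/
instance instStructureSubgroup (G : AddSubgroup ℚ) : groupLang.Structure G where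
  funMap := fun {_} f =>
    match f with
    | GroupFunc.one => fun _ => 0
    | GroupFunc.inv => fun a => -(a 0)
    | GroupFunc.mul => fun a => a 0 + a 1
  RelMap := fun {_} r => nomatch r

/-- The identity symbol as a term. -/
def tOne {α : Type} : groupLang.Term α := .func (l := 0) GroupFunc.one Fin.elim0

/-- The inverse of a term. -/
def tInv {α : Type} (t : groupLang.Term α) : groupLang.Term α :=
  .func (l := 1) GroupFunc.inv ![t]

/-- The product of two terms. -/
def tMul {α : Type} (s t : groupLang.Term α) : groupLang.Term α :=
  .func (l := 2) GroupFunc.mul ![s, t]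

/-- Gödel number of a term whose variables (or constants) are natural numbers. -/
def termCode : groupLang.Term ℕ → ℕ
  | .var n => 3 * n + 1
  | .func (l := 0) GroupFunc.one _ => 0
  | .func (l := 1) GroupFunc.inv ts => 3 * termCode (ts 0) + 2
  | .func (l := 2) GroupFunc.mul ts => 3 * Nat.pair (termCode (ts 0)) (termCode (ts 1)) + 3

/-- The term with a given Gödel number. -/
def termOfCode : ℕ → groupLang.Term ℕ
  | 0 => tOne
  | m + 1 =>
    if m % 3 = 0 then .var (m / 3)
    else if m % 3 = 1 then tInv (termOfCode (m / 3))
    else tMul (termOfCode (m / 3).unpair.1) (termOfCode (m / 3).unpair.2)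
termination_by m => m
decreasing_by
  · omega
  · have := Nat.unpair_left_le (m / 3); omega
  · have := Nat.unpair_right_le (m / 3); omega

theorem termOfCode_termCode (t : groupLang.Term ℕ) : termOfCode (termCode t) = t := by
  induction t with
  | var n =>
    rw [termCode, termOfCode]
    simp
  | @func l f ts ih =>
    match l, f, ts, ih with
    | 0, GroupFunc.one, ts, ih =>
      rw [termCode, termOfCode, tOne]
      exact congrArg _ (Subsingleton.elim _ _)
    | 1, GroupFunc.inv, ts, ih =>
      have h1 : (3 * termCode (ts 0) + 1) % 3 = 1 := by omega
      have h2 : (3 * termCode (ts 0) + 1) / 3 = termCode (ts 0) := by omega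
      rw [termCode, termOfCode, h1, h2, ih 0]
      simp only [one_ne_zero, if_false, if_true, tInv]
      congr 1
      funext i
      fin_cases i
      rfl
    | 2, GroupFunc.mul, ts, ih =>
      have h1 : (3 * Nat.pair (termCode (ts 0)) (termCode (ts 1)) + 2) % 3 = 2 := by omega
      have h2 : (3 * Nat.pair (termCode (ts 0)) (termCode (ts 1)) + 2) / 3
          = Nat.pair (termCode (ts 0)) (termCode (ts 1)) := by omega
      rw [termCode, termOfCode, h1, h2, Nat.unpair_pair, ih 0, ih 1]
      simp only [OfNat.ofNat_ne_zero, OfNat.ofNat_ne_one, if_false, tMul]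
      congr 1
      funext i
      fin_cases i <;> rfl

theorem termCode_termOfCode (n : ℕ) : termCode (termOfCode n) = n := by
  induction n using Nat.strong_induction_on with
  | _ n ih =>
    match n, ih with
    | 0, _ => rw [termOfCode]; rfl
    | m + 1, ih =>
      have hl := Nat.unpair_left_le (m / 3)
      have hr := Nat.unpair_right_le (m / 3)
      rw [termOfCode]
      split_ifs with h0 h1
      · rw [termCode]; omega
      · have := ih (m / 3) (by omega)
        simp only [tInv, termCode, Matrix.cons_val_zero, this]; omega
      · have e1 := ih (m / 3).unpair.1 (by omega)
        have e2 := ih (m / 3).unpair.2 (by omega)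
        simp only [tMul, termCode, Matrix.cons_val_zero, Matrix.cons_val_one, e1, e2,
          Nat.pair_unpair]
        omega

/-! ### Infinitary formulas in normal form -/

/-- Finitary quantifier-free formulas with negations next to the atomic formulas.
`lit true s t` is the equation `s = t` and `lit false s t` its negation. -/
inductive QF : Type
  | lit (b : Bool) (s t : groupLang.Term ℕ) : QF
  | and (q r : QF) : QF
  | or (q r : QF) : QF

namespace QF

/-- Gödel number of a finitary quantifier-free formula. -/
def code : QF → ℕ
  | lit false s t => 4 * Nat.pair (termCode s) (termCode t)
  | lit true s t => 4 * Nat.pair (termCode s) (termCode t) + 1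
  | and q r => 4 * Nat.pair q.code r.code + 2
  | or q r => 4 * Nat.pair q.code r.code + 3

/-- The finitary quantifier-free formula with a given Gödel number. -/
def ofCode (m : ℕ) : QF :=
  if m % 4 = 0 then
    lit false (termOfCode (m / 4).unpair.1) (termOfCode (m / 4).unpair.2)
  else if m % 4 = 1 then
    lit true (termOfCode (m / 4).unpair.1) (termOfCode (m / 4).unpair.2)
  else if m % 4 = 2 then and (ofCode (m / 4).unpair.1) (ofCode (m / 4).unpair.2)
  else or (ofCode (m / 4).unpair.1) (ofCode (m / 4).unpair.2)
termination_by m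
decreasing_by
  all_goals
    have := Nat.unpair_left_le (m / 4)
    have := Nat.unpair_right_le (m / 4)
    omega

theorem ofCode_code (q : QF) : ofCode q.code = q := by
  induction q with
  | lit b s t =>
    cases b
    · rw [code, ofCode]
      simp [termOfCode_termCode]
    · have h1 : (4 * Nat.pair (termCode s) (termCode t) + 1) % 4 = 1 := by omega
      have h2 : (4 * Nat.pair (termCode s) (termCode t) + 1) / 4
          = Nat.pair (termCode s) (termCode t) := by omega
      rw [code, ofCode, h1, h2]
      simp [termOfCode_termCode]
  | and q r hq hr =>
    have h1 : (4 * Nat.pair q.code r.code + 2) % 4 = 2 := by omega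
    have h2 : (4 * Nat.pair q.code r.code + 2) / 4 = Nat.pair q.code r.code := by omega
    rw [code, ofCode, h1, h2]
    simp [hq, hr]
  | or q r hq hr =>
    have h1 : (4 * Nat.pair q.code r.code + 3) % 4 = 3 := by omega
    have h2 : (4 * Nat.pair q.code r.code + 3) / 4 = Nat.pair q.code r.code := by omega
    rw [code, ofCode, h1, h2]
    simp [hq, hr]

/-- Truth of a finitary quantifier-free formula under an assignment of the variables. -/
def Realize {M : Type} [groupLang.Structure M] (v : ℕ → M) : QF → Prop
  | lit true s t => s.realize v = t.realize v
  | lit false s t => s.realize v ≠ t.realize v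
  | and q r => q.Realize v ∧ r.Realize v
  | or q r => q.Realize v ∨ r.Realize v

/-- The variables that occur in a finitary quantifier-free formula. -/
def freeVars : QF → Set ℕ
  | lit _ s t => (s.varFinset : Set ℕ) ∪ (t.varFinset : Set ℕ)
  | and q r => q.freeVars ∪ r.freeVars
  | or q r => q.freeVars ∪ r.freeVars

end QF

/-- Formulas of `L_{ω₁ω}` in normal form, in the language of groups. The variables are indexed by
the natural numbers; `disj I φ` is the disjunction and `conj I φ` the conjunction of the countable
family of the `φ i` with `i ∈ I`. -/
inductive InfFormula : Type
  | qf (q : QF) : InfFormula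
  | disj (I : Set ℕ) (φ : ℕ → InfFormula) : InfFormula
  | conj (I : Set ℕ) (φ : ℕ → InfFormula) : InfFormula
  | ex (x : ℕ) (φ : InfFormula) : InfFormula
  | all (x : ℕ) (φ : InfFormula) : InfFormula

namespace InfFormula

/-- Truth of an infinitary formula under an assignment of the variables. -/
def Realize {M : Type} [groupLang.Structure M] : InfFormula → (ℕ → M) → Prop
  | qf q, v => q.Realize v
  | disj I φ, v => ∃ i ∈ I, (φ i).Realize v
  | conj I φ, v => ∀ i ∈ I, (φ i).Realize v
  | ex x φ, v => ∃ a : M, φ.Realize (Function.update v x a)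
  | all x φ, v => ∀ a : M, φ.Realize (Function.update v x a)

/-- The free variables of an infinitary formula. -/
def freeVars : InfFormula → Set ℕ
  | qf q => q.freeVars
  | disj I φ => ⋃ i ∈ I, (φ i).freeVars
  | conj I φ => ⋃ i ∈ I, (φ i).freeVars
  | ex x φ => φ.freeVars \ {x}
  | all x φ => φ.freeVars \ {x}

/-- A sentence is a formula without free variables. -/
def IsSentence (φ : InfFormula) : Prop := φ.freeVars = ∅

/-- A structure is a model of a sentence. -/
def Models (M : Type) [groupLang.Structure M] (φ : InfFormula) : Prop :=
  ∀ v : ℕ → M, φ.Realize v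

/-- A sentence whose countable models are exactly the isomorphic copies of `A`. -/
def IsScottSentence (φ : InfFormula) (A : Type) [groupLang.Structure A] : Prop :=
  φ.IsSentence ∧
    ∀ (M : Type) [groupLang.Structure M] [Countable M], φ.Models M ↔ Nonempty (M ≃[groupLang] A)

end InfFormula

/-! ### Computable infinitary formulas -/

/-- The partial computable function `φ_e`. -/
def phi (e : ℕ) : ℕ →. ℕ := (Denumerable.ofNat Code e).eval

/-- The c.e. set `W_e`, the domain of `φ_e`. -/
def W (e : ℕ) : Set ℕ := {n | (phi e n).Dom}

/-- `formulaOfIndex n true e` is the computable `Σ_n` formula with index `e`, and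
`formulaOfIndex n false e` is the computable `Π_n` formula with index `e`.

At level `0` the index is the Gödel number of a finitary quantifier-free formula. At level `n > 0`
a number `i` stands for a triple `(β, y, j)` of a level, a finite tuple of variables and an index;
the computable `Σ_n` formula with index `e` is the disjunction, over the `i` in the c.e. set `W_e`
with `β < n`, of the formulas `(∃ y) ψ`, where `ψ` is the computable `Π_β` formula with index `j`,
and dually for `Π_n`. -/
def formulaOfIndex : ℕ → Bool → ℕ → InfFormula
  | 0, _, e => .qf (QF.ofCode e)
  | n + 1, true, e =>
    .disj {i | i ∈ W e ∧ (Denumerable.ofNat (ℕ × List ℕ × ℕ) i).1 < n + 1} fun i =>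
      let d := Denumerable.ofNat (ℕ × List ℕ × ℕ) i
      d.2.1.foldr InfFormula.ex (formulaOfIndex (min d.1 n) false d.2.2)
  | n + 1, false, e =>
    .conj {i | i ∈ W e ∧ (Denumerable.ofNat (ℕ × List ℕ × ℕ) i).1 < n + 1} fun i =>
      let d := Denumerable.ofNat (ℕ × List ℕ × ℕ) i
      d.2.1.foldr InfFormula.all (formulaOfIndex (min d.1 n) true d.2.2)
termination_by n => n
decreasing_by all_goals exact Nat.lt_succ_of_le (min_le_right _ _)

/-- The formula `φ` is computable `Σ_n`. -/
def IsComputableSigma (n : ℕ) (φ : InfFormula) : Prop := ∃ e : ℕ, φ = formulaOfIndex n true e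

/-! ### Computable structures and index sets -/

/-- The atomic diagram of a structure whose universe is a set `U` of natural numbers: the set of
Gödel numbers of the equations between closed terms with constants from `U` that are true in the
structure, and of the negations of those that are false in it. -/
def diagram (U : Set ℕ) [groupLang.Structure U] : Set ℕ :=
  {n | ∃ s t : groupLang.Term U,
    (s.realize (id : U → U) = t.realize id ∧
      n = (QF.lit true (s.relabel Subtype.val) (t.relabel Subtype.val)).code) ∨
    (s.realize (id : U → U) ≠ t.realize id ∧
      n = (QF.lit false (s.relabel Subtype.val) (t.relabel Subtype.val)).code)}

/-- `A` has a computable copy: it is isomorphic to a structure with universe a set of natural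
numbers and with a computable atomic diagram. -/
def HasComputableCopy (A : Type) [groupLang.Structure A] : Prop :=
  ∃ (U : Set ℕ) (_ : groupLang.Structure U),
    Nonempty (U ≃[groupLang] A) ∧ ComputablePred (fun n => n ∈ diagram U)

open Classical in
/-- The index set `I(A)`: the set of all `e` such that `φ_e` is the characteristic function of the
atomic diagram of a copy of `A`. -/
noncomputable def indexSet (A : Type) [groupLang.Structure A] : Set ℕ :=
  {e | ∃ (U : Set ℕ) (_ : groupLang.Structure U),
    Nonempty (U ≃[groupLang] A) ∧ ∀ n, phi e n = Part.some (if n ∈ diagram U then 1 else 0)}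

/-- A set of natural numbers is `Σ⁰₃`. -/
def IsSigma03 (S : Set ℕ) : Prop :=
  ∃ R : ℕ × ℕ × ℕ × ℕ → Prop, ComputablePred R ∧
    ∀ n, n ∈ S ↔ ∃ x, ∀ y, ∃ z, R (n, x, y, z)

/-- A set of natural numbers is `m`-complete `Σ⁰₃`. -/
def IsMCompleteSigma03 (S : Set ℕ) : Prop :=
  IsSigma03 S ∧ ∀ T : Set ℕ, IsSigma03 T → ManyOneReducible (fun n => n ∈ T) (fun n => n ∈ S)

/-! ### The partition of the primes given by an element of a subgroup of the rationals -/

/-- The natural number `m` divides the element `u` in the group `G`. -/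
def DividesIn (G : AddSubgroup ℚ) (m : ℕ) (u : G) : Prop := ∃ y : G, m • y = u

/-- The set `P⁰` of primes that do not divide `u` in `G`. -/
def PZero (G : AddSubgroup ℚ) (u : G) : Set ℕ :=
  {p | p.Prime ∧ ¬ DividesIn G p u}

/-- The set `P^fin` of primes for which a positive power, but not every power, divides `u`. -/
def PFin (G : AddSubgroup ℚ) (u : G) : Set ℕ :=
  {p | p.Prime ∧ ∃ k > 0, DividesIn G (p ^ k) u ∧ ¬ DividesIn G (p ^ (k + 1)) u}

/-- The set `P^∞` of primes all of whose powers divide `u` in `G`. -/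
def PInf (G : AddSubgroup ℚ) (u : G) : Set ℕ :=
  {p | p.Prime ∧ ∀ k > 0, DividesIn G (p ^ k) u}

end ScottQ

/-! Replacing `G` by its isomorphic copy `R = {q : q u ∈ G}` turns `u` into `1`. A search through
the atomic diagram of a computable copy of `G` lists `R` as `rat (E 0), rat (E 1), ...` with `E`
computable (`exists_enum_normalize`).

A structure is a copy of `R` exactly when it is a torsion-free abelian group with a nontrivial
element `x` such that `q x` exists for every `q` in the list and every element is `q x` for some `q`
in the list. In a torsion-free group the relation `y = q x` determines `y` and `q` from each other,
so it is an isomorphism (`RankOne.nonempty_equiv`). The axioms have the shape "there is `x` such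
that for all ... there are ...", over computable families. This gives the `Σ₃` Scott sentence
(`exists_scottSentence`). Read in the atomic diagram, they are `Π⁰₂` once `x` is fixed, and so is
the statement that `φ_e` decides an atomic diagram. Hence the index set is `Σ⁰₃`
(`isSigma03_indexSet`).

For hardness, a `Σ⁰₃` set `S` is first reduced to cofiniteness of uniformly c.e. sets `V_n`
(`exists_cofinite_of_isSigma03`). As infinitely many primes divide `1` in `R`, there is a computable
sequence `q j > j` of such primes. Let `B_n` be the set of the `q j` with `j ∉ V_n`, and let `H_n`
consist of the `r ∈ R` with `r / b ∈ R` for all `b ∈ B_n`. If `B_n` is finite, then `H_n` is `R`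
multiplied by the product of `B_n`, a copy of `R`. If `B_n` is infinite, then `H_n` is not a copy:
an isomorphism from `R` multiplies by some rational, and a large `b ∈ B_n` of finite exponent in `R`
would gain one more power (`finite_of_shrink_equiv`). Finally `H_n` is c.e. uniformly in `n`,
because only primes up to the denominator of `r` need testing (`mem_shrink_rat`), and uniformly c.e.
groups of rationals have uniformly computable copies (`exists_computable_copies`). -/

namespace ScottQ

open FirstOrder Nat.Partrec

/-! ### Computable functions -/

attribute [fun_prop] Computable Computable.id Computable.const Computable.comp

section Computable

variable {α β γ σ : Type*} [Primcodable α] [Primcodable β] [Primcodable γ] [Primcodable σ]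

@[fun_prop] theorem computable_fst {f : α → β × γ} (hf : Computable f) :
    Computable fun a => (f a).1 := Computable.fst.comp hf

@[fun_prop] theorem computable_snd {f : α → β × γ} (hf : Computable f) :
    Computable fun a => (f a).2 := Computable.snd.comp hf

@[fun_prop] theorem computable_mk {f : α → β} {g : α → γ} (hf : Computable f)
    (hg : Computable g) : Computable fun a => (f a, g a) := Computable.pair hf hg

@[fun_prop] theorem computable_add {f g : α → ℕ} (hf : Computable f) (hg : Computable g) :
    Computable fun a => f a + g a := Primrec.nat_add.to_comp.comp hf hg

@[fun_prop] theorem computable_mul {f g : α → ℕ} (hf : Computable f) (hg : Computable g) :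
    Computable fun a => f a * g a := Primrec.nat_mul.to_comp.comp hf hg

@[fun_prop] theorem computable_sub {f g : α → ℕ} (hf : Computable f) (hg : Computable g) :
    Computable fun a => f a - g a := Primrec.nat_sub.to_comp.comp hf hg

@[fun_prop] theorem computable_div {f g : α → ℕ} (hf : Computable f) (hg : Computable g) :
    Computable fun a => f a / g a := Primrec.nat_div.to_comp.comp hf hg

@[fun_prop] theorem computable_mod {f g : α → ℕ} (hf : Computable f) (hg : Computable g) :
    Computable fun a => f a % g a := Primrec.nat_mod.to_comp.comp hf hg

@[fun_prop] theorem computable_pair {f g : α → ℕ} (hf : Computable f) (hg : Computable g) :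
    Computable fun a => Nat.pair (f a) (g a) := Primrec₂.natPair.to_comp.comp hf hg

@[fun_prop] theorem computable_unpair {f : α → ℕ} (hf : Computable f) :
    Computable fun a => Nat.unpair (f a) := Computable.unpair.comp hf

@[fun_prop] theorem computable_and {f g : α → Bool} (hf : Computable f) (hg : Computable g) :
    Computable fun a => f a && g a := Primrec.and.to_comp.comp hf hg

@[fun_prop] theorem computable_or {f g : α → Bool} (hf : Computable f) (hg : Computable g) :
    Computable fun a => f a || g a := Primrec.or.to_comp.comp hf hg

@[fun_prop] theorem computable_not {f : α → Bool} (hf : Computable f) :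
    Computable fun a => !f a := Primrec.not.to_comp.comp hf

@[fun_prop] theorem computable_beq {f g : α → ℕ} (hf : Computable f) (hg : Computable g) :
    Computable fun a => f a == g a := Primrec.beq.to_comp.comp hf hg

@[fun_prop] theorem computable_ble {f g : α → ℕ} (hf : Computable f) (hg : Computable g) :
    Computable fun a => Nat.ble (f a) (g a) :=
  ((PrimrecRel.decide Primrec.nat_le).to_comp.comp hf hg).of_eq fun a => by
    rw [Bool.eq_iff_iff]; simp

@[fun_prop] theorem computable_cond {c : α → Bool} {f g : α → σ} (hc : Computable c)
    (hf : Computable f) (hg : Computable g) : Computable fun a => cond (c a) (f a) (g a) :=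
  Computable.cond hc hf hg

@[fun_prop] theorem computable_some {f : α → σ} (hf : Computable f) :
    Computable fun a => some (f a) := Computable.option_some.comp hf

@[fun_prop] theorem computable_getD {f : α → Option σ} {g : α → σ} (hf : Computable f)
    (hg : Computable g) : Computable fun a => (f a).getD (g a) := Computable.option_getD hf hg

@[fun_prop] theorem computable_isSome {f : α → Option σ} (hf : Computable f) :
    Computable fun a => (f a).isSome := Primrec.option_isSome.to_comp.comp hf

@[fun_prop] theorem computable_getElem? {f : α → List σ} {g : α → ℕ} (hf : Computable f)
    (hg : Computable g) : Computable fun a => (f a)[g a]? := Computable.list_getElem?.comp hf hg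

@[fun_prop] theorem computable_length {f : α → List σ} (hf : Computable f) :
    Computable fun a => (f a).length := Computable.list_length.comp hf

@[fun_prop] theorem computable_encode {f : α → σ} (hf : Computable f) :
    Computable fun a => Encodable.encode (f a) := Computable.encode.comp hf

@[fun_prop] theorem computable_ofNat {δ : Type*} [Denumerable δ] {f : α → ℕ}
    (hf : Computable f) : Computable fun a => Denumerable.ofNat δ (f a) :=
  (Computable.ofNat δ).comp hf

theorem computablePred_iff {p : α → Prop} :
    ComputablePred p ↔ ∃ f : α → Bool, Computable f ∧ ∀ a, p a ↔ f a = true := by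
  rw [ComputablePred.computable_iff]
  constructor
  · rintro ⟨f, hf, rfl⟩; exact ⟨f, hf, fun _ => Iff.rfl⟩
  · rintro ⟨f, hf, h⟩; exact ⟨f, hf, funext fun a => propext (h a)⟩

/-- Bounded universal quantification of a Boolean function. -/
def ballBool (f : ℕ → Bool) (n : ℕ) : Bool := Nat.rec true (fun i b => b && f i) n

theorem ballBool_eq_true {f : ℕ → Bool} {n : ℕ} : ballBool f n = true ↔ ∀ i < n, f i = true := by
  induction n with
  | zero => simp [ballBool]
  | succ n ih =>
    have : ballBool f (n + 1) = (ballBool f n && f n) := rfl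
    rw [this, Bool.and_eq_true, ih, Nat.forall_lt_succ_right]

theorem computable_ballBool {f : α → ℕ → Bool} {n : α → ℕ}
    (hf : Computable fun p : α × ℕ => f p.1 p.2) (hn : Computable n) :
    Computable fun a => ballBool (f a) (n a) :=
  Computable.nat_rec hn (Computable.const true)
    (h := fun a p => p.2 && f a p.1)
    (by
      have : Computable fun q : α × ℕ × Bool => f q.1 q.2.1 :=
        hf.comp (Computable.pair Computable.fst (Computable.fst.comp Computable.snd))
      exact (computable_and (computable_snd Computable.snd) this).to₂)

end Computable

/-! ### Predicates that are `Σ⁰₁` -/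

/-- The predicate `P` is `Σ⁰₁`. -/
def IsSigma01 {α : Type*} [Primcodable α] (P : α → Prop) : Prop :=
  ∃ f : α × ℕ → Bool, Computable f ∧ ∀ a, P a ↔ ∃ z, f (a, z) = true

namespace IsSigma01

variable {α β : Type*} [Primcodable α] [Primcodable β] {P Q : α → Prop}

theorem of_bool {f : α → Bool} (hf : Computable f) : IsSigma01 fun a => f a = true :=
  ⟨fun p => f p.1, by fun_prop, fun a => by simp⟩

theorem of_iff (hP : IsSigma01 P) (h : ∀ a, Q a ↔ P a) : IsSigma01 Q := by
  obtain ⟨f, hf, hfP⟩ := hP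
  exact ⟨f, hf, fun a => (h a).trans (hfP a)⟩

theorem of_computable {f : α → Bool} (hf : Computable f) (h : ∀ a, P a ↔ f a = true) :
    IsSigma01 P := (of_bool hf).of_iff h

theorem comp {P : β → Prop} (hP : IsSigma01 P) {g : α → β} (hg : Computable g) :
    IsSigma01 fun a => P (g a) := by
  obtain ⟨f, hf, hfP⟩ := hP
  exact ⟨fun p => f (g p.1, p.2), by fun_prop, fun a => hfP _⟩

theorem ex {P : α → ℕ → Prop} (hP : IsSigma01 fun p : α × ℕ => P p.1 p.2) :
    IsSigma01 fun a => ∃ n, P a n := by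
  obtain ⟨f, hf, hfP⟩ := hP
  refine ⟨fun p => f ((p.1, p.2.unpair.1), p.2.unpair.2), by fun_prop, fun a => ?_⟩
  constructor
  · rintro ⟨n, hn⟩
    obtain ⟨z, hz⟩ := (hfP (a, n)).1 hn
    exact ⟨Nat.pair n z, by simpa using hz⟩
  · rintro ⟨z, hz⟩
    exact ⟨_, (hfP (a, z.unpair.1)).2 ⟨_, hz⟩⟩

theorem and (hP : IsSigma01 P) (hQ : IsSigma01 Q) : IsSigma01 fun a => P a ∧ Q a := by
  obtain ⟨f, hf, hfP⟩ := hP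
  obtain ⟨g, hg, hgQ⟩ := hQ
  refine ⟨fun p => f (p.1, p.2.unpair.1) && g (p.1, p.2.unpair.2), by fun_prop, fun a => ?_⟩
  change P a ∧ Q a ↔ _
  rw [hfP, hgQ]
  constructor
  · rintro ⟨⟨y, hy⟩, z, hz⟩
    exact ⟨Nat.pair y z, by simp [hy, hz]⟩
  · rintro ⟨z, hz⟩
    simp only [Bool.and_eq_true] at hz
    exact ⟨⟨_, hz.1⟩, _, hz.2⟩

theorem or (hP : IsSigma01 P) (hQ : IsSigma01 Q) : IsSigma01 fun a => P a ∨ Q a := by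
  obtain ⟨f, hf, hfP⟩ := hP
  obtain ⟨g, hg, hgQ⟩ := hQ
  refine ⟨fun p => f p || g p, by fun_prop, fun a => ?_⟩
  simp only [hfP, hgQ, Bool.or_eq_true, exists_or]

theorem ball {P : α → ℕ → Prop} (hP : IsSigma01 fun p : α × ℕ => P p.1 p.2) {g : α → ℕ}
    (hg : Computable g) : IsSigma01 fun a => ∀ i < g a, P a i := by
  obtain ⟨f, hf, hfP⟩ := hP
  -- The witnesses for all `i` below the bound are packed into one coded list. The default `0`
  -- serves only positions past its end.
  refine ⟨fun p => ballBool
    (fun i => f ((p.1, i), ((Denumerable.ofNat (List ℕ) p.2)[i]?).getD 0)) (g p.1), ?_,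
    fun a => ?_⟩
  · apply computable_ballBool <;> fun_prop
  · simp only [ballBool_eq_true]
    constructor
    · intro h
      have h' : ∀ i, ∃ z, i < g a → f ((a, i), z) = true := fun i => by
        by_cases hi : i < g a
        · obtain ⟨z, hz⟩ := (hfP (a, i)).1 (h i hi)
          exact ⟨z, fun _ => hz⟩
        · exact ⟨0, fun h => absurd h hi⟩
      choose z hz using h'
      refine ⟨Encodable.encode ((List.range (g a)).map z), fun i hi => ?_⟩
      simpa [hi] using hz i hi
    · rintro ⟨w, hw⟩ i hi
      exact (hfP (a, i)).2 ⟨_, hw i hi⟩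

/-- A `Σ⁰₁` set with a known element has a uniformly computable enumeration. -/
theorem exists_enum {δ : Type*} [Denumerable δ] {P : α × δ → Prop} (hP : IsSigma01 P) (d : δ)
    (hd : ∀ a, P (a, d)) :
    ∃ h : α × ℕ → δ, Computable h ∧ ∀ a t, P (a, t) ↔ ∃ n, h (a, n) = t := by
  obtain ⟨f, hf, hfP⟩ := hP
  -- A number codes a candidate together with a witness; when the check fails, the known element `d`
  -- is listed again.
  refine ⟨fun p => bif f ((p.1, (Denumerable.ofNat (δ × ℕ) p.2).1),
    (Denumerable.ofNat (δ × ℕ) p.2).2) then (Denumerable.ofNat (δ × ℕ) p.2).1 else d,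
    by fun_prop, fun a t => ?_⟩
  constructor
  · intro h
    obtain ⟨z, hz⟩ := (hfP _).1 h
    exact ⟨Encodable.encode (t, z), by simp [hz]⟩
  · rintro ⟨n, rfl⟩
    simp only
    cases h : f ((a, (Denumerable.ofNat (δ × ℕ) n).1), (Denumerable.ofNat (δ × ℕ) n).2)
    · exact hd a
    · exact (hfP _).2 ⟨_, h⟩

end IsSigma01

/-- Evaluation with bounded resources is computable, and the bound serves as the existential
witness. -/
theorem isSigma01_mem_phi (k : ℕ) : IsSigma01 fun p : ℕ × ℕ => k ∈ phi p.1 p.2 := by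
  refine ⟨fun q => (Code.evaln q.2 (Denumerable.ofNat Code q.1.1) q.1.2).isSome &&
    (Code.evaln q.2 (Denumerable.ofNat Code q.1.1) q.1.2).getD 0 == k, ?_, fun p => ?_⟩
  · have : Computable fun q : (ℕ × ℕ) × ℕ =>
        Code.evaln q.2 (Denumerable.ofNat Code q.1.1) q.1.2 :=
      Code.primrec_evaln.to_comp.comp (g := fun q : (ℕ × ℕ) × ℕ =>
        ((q.2, Denumerable.ofNat Code q.1.1), q.1.2)) (by fun_prop)
    fun_prop
  · refine Code.evaln_complete.trans (exists_congr fun z => ?_)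
    generalize ho : Code.evaln z (Denumerable.ofNat Code p.1) p.2 = o
    simp only [ho]
    cases o <;> simp

/-- Indices of a uniformly computable family of partial computable functions. -/
theorem exists_phi_eq {f : ℕ × ℕ →. ℕ} (hf : Partrec f) :
    ∃ g : ℕ → ℕ, Computable g ∧ ∀ a n, phi (g a) n = f (a, n) := by
  have h' : Nat.Partrec fun n => f n.unpair :=
    Partrec.nat_iff.1 (hf.comp Computable.unpair)
  obtain ⟨c, hc⟩ := Code.exists_code.1 h'
  refine ⟨fun a => Encodable.encode (Code.curry c a),
    Computable.encode.comp (Code.primrec₂_curry.to_comp.comp (Computable.const c) Computable.id),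
    fun a n => ?_⟩
  rw [phi, Denumerable.ofNat_encode, Code.eval_curry, hc]
  simp

/-- The function with index `g a` searches for a witness of `P (a, n)`, so it halts exactly when
there is one. -/
theorem exists_W_eq {P : ℕ × ℕ → Prop} (hP : IsSigma01 P) :
    ∃ g : ℕ → ℕ, Computable g ∧ ∀ a n, n ∈ W (g a) ↔ P (a, n) := by
  obtain ⟨f, hf, hfP⟩ := hP
  obtain ⟨g, hg, hgf⟩ := exists_phi_eq (f := fun p => Nat.rfind fun z => Part.some (f (p, z)))
    (Partrec.rfind hf.partrec)
  refine ⟨g, hg, fun a n => ?_⟩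
  change (phi (g a) n).Dom ↔ _
  rw [hgf, hfP]
  refine Nat.rfind_dom.trans ?_
  constructor
  · rintro ⟨z, hz, -⟩
    exact ⟨z, (Part.mem_some_iff.1 hz).symm⟩
  · rintro ⟨z, hz⟩
    exact ⟨z, Part.mem_some_iff.2 hz.symm, fun _ => trivial⟩

/-! ### Terms and literals -/

section Terms

variable {α β : Type}

theorem relabel_tOne (f : α → β) : (tOne : groupLang.Term α).relabel f = tOne := by
  simp only [tOne, Language.Term.relabel]
  exact congrArg _ (Subsingleton.elim _ _)

theorem relabel_tInv (f : α → β) (t : groupLang.Term α) :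
    (tInv t).relabel f = tInv (t.relabel f) := by
  simp only [tInv, Language.Term.relabel]
  congr 1; funext i; fin_cases i; rfl

theorem relabel_tMul (f : α → β) (s t : groupLang.Term α) :
    (tMul s t).relabel f = tMul (s.relabel f) (t.relabel f) := by
  simp only [tMul, Language.Term.relabel]
  congr 1; funext i; fin_cases i <;> rfl

/-- The induction principle for terms in the language of groups. -/
theorem term_induction {C : groupLang.Term α → Prop} (hvar : ∀ a, C (.var a)) (hone : C tOne)
    (hinv : ∀ t, C t → C (tInv t)) (hmul : ∀ s t, C s → C t → C (tMul s t)) (t) : C t := by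
  induction t with
  | var a => exact hvar a
  | @func l f ts ih =>
    match l, f, ts, ih with
    | 0, GroupFunc.one, ts, ih =>
      convert hone
      exact congrArg _ (Subsingleton.elim _ _)
    | 1, GroupFunc.inv, ts, ih =>
      convert hinv _ (ih 0)
      unfold tInv
      congr 1; funext i; fin_cases i; rfl
    | 2, GroupFunc.mul, ts, ih =>
      convert hmul _ _ (ih 0) (ih 1)
      unfold tMul
      congr 1; funext i; fin_cases i <;> rfl

theorem termCode_var (n : ℕ) : termCode (.var n) = 3 * n + 1 := by rw [termCode]

theorem termCode_tInv (t : groupLang.Term ℕ) : termCode (tInv t) = 3 * termCode t + 2 := by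
  rw [tInv, termCode]; rfl

theorem termCode_tMul (s t : groupLang.Term ℕ) :
    termCode (tMul s t) = 3 * Nat.pair (termCode s) (termCode t) + 3 := by
  rw [tMul, termCode]; rfl

/-- Terms are numbered by their Gödel numbers. -/
instance denumerableTerm : Denumerable (groupLang.Term ℕ) :=
  Denumerable.mk' ⟨termCode, termOfCode, termOfCode_termCode, termCode_termOfCode⟩

theorem encode_term (t : groupLang.Term ℕ) : Encodable.encode t = termCode t := rfl

variable {σ : Type*} [Primcodable σ]

@[fun_prop] theorem computable_tInv {f : σ → groupLang.Term ℕ} (hf : Computable f) :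
    Computable fun a => tInv (f a) := by
  rw [← Computable.encode_iff]
  simp only [encode_term, termCode_tInv]
  have := Computable.encode.comp hf
  simp only [encode_term] at this
  fun_prop

@[fun_prop] theorem computable_tMul {f g : σ → groupLang.Term ℕ} (hf : Computable f)
    (hg : Computable g) : Computable fun a => tMul (f a) (g a) := by
  rw [← Computable.encode_iff]
  simp only [encode_term, termCode_tMul]
  have h1 := Computable.encode.comp hf
  have h2 := Computable.encode.comp hg
  simp only [encode_term] at h1 h2
  fun_prop

@[fun_prop] theorem computable_var {f : σ → ℕ} (hf : Computable f) :
    Computable fun a => (.var (f a) : groupLang.Term ℕ) := by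
  rw [← Computable.encode_iff]
  simp only [encode_term, termCode_var]
  fun_prop

@[fun_prop] theorem computable_termCode {f : σ → groupLang.Term ℕ} (hf : Computable f) :
    Computable fun a => termCode (f a) := Computable.encode.comp hf

/-- The `n`-th power of a term. -/
def tPow (n : ℕ) (t : groupLang.Term α) : groupLang.Term α := Nat.rec tOne (fun _ s => tMul s t) n

theorem relabel_tPow (f : α → β) (n : ℕ) (t : groupLang.Term α) :
    (tPow n t).relabel f = tPow n (t.relabel f) := by
  induction n with
  | zero => exact relabel_tOne f
  | succ n ih =>
    have h1 : tPow (n + 1) t = tMul (tPow n t) t := rfl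
    have h2 : tPow (n + 1) (t.relabel f) = tMul (tPow n (t.relabel f)) (t.relabel f) := rfl
    rw [h1, h2, relabel_tMul, ih]

@[fun_prop] theorem computable_tPow {f : σ → ℕ} {g : σ → groupLang.Term ℕ} (hf : Computable f)
    (hg : Computable g) : Computable fun a => tPow (f a) (g a) :=
  Computable.nat_rec hf (Computable.const tOne) (h := fun a p => tMul p.2 (g a))
    (by
      have : Computable fun q : σ × ℕ × groupLang.Term ℕ => tMul q.2.2 (g q.1) := by fun_prop
      exact this.to₂)

/-! ### The operations of a structure and the values of terms -/

variable {M : Type} [groupLang.Structure M]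

/-- The identity element of a structure for the language of groups. -/
def sOne (M : Type) [groupLang.Structure M] : M :=
  Language.Structure.funMap (L := groupLang) GroupFunc.one Fin.elim0

/-- The inverse in a structure for the language of groups. -/
def sInv (a : M) : M := Language.Structure.funMap (L := groupLang) GroupFunc.inv ![a]

/-- The product in a structure for the language of groups. -/
def sMul (a b : M) : M := Language.Structure.funMap (L := groupLang) GroupFunc.mul ![a, b]

theorem funMap_one (x : Fin 0 → M) :
    Language.Structure.funMap (L := groupLang) GroupFunc.one x = sOne M :=
  congrArg _ (Subsingleton.elim _ _)

theorem funMap_inv (x : Fin 1 → M) :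
    Language.Structure.funMap (L := groupLang) GroupFunc.inv x = sInv (x 0) := by
  unfold sInv; congr 1; funext i; fin_cases i; rfl

theorem funMap_mul (x : Fin 2 → M) :
    Language.Structure.funMap (L := groupLang) GroupFunc.mul x = sMul (x 0) (x 1) := by
  unfold sMul; congr 1; funext i; fin_cases i <;> rfl

@[simp] theorem realize_tOne (v : α → M) : (tOne : groupLang.Term α).realize v = sOne M :=
  funMap_one _

@[simp] theorem realize_tInv (v : α → M) (t : groupLang.Term α) :
    (tInv t).realize v = sInv (t.realize v) := funMap_inv _

@[simp] theorem realize_tMul (v : α → M) (s t : groupLang.Term α) :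
    (tMul s t).realize v = sMul (s.realize v) (t.realize v) := funMap_mul _

/-- The `n`-th power of an element. -/
def sPow (n : ℕ) (a : M) : M := Nat.rec (sOne M) (fun _ s => sMul s a) n

@[simp] theorem realize_tPow (v : α → M) (n : ℕ) (t : groupLang.Term α) :
    (tPow n t).realize v = sPow n (t.realize v) := by
  induction n with
  | zero => exact realize_tOne v
  | succ n ih =>
    have h1 : tPow (n + 1) t = tMul (tPow n t) t := rfl
    have h2 : sPow (n + 1) (t.realize v) = sMul (sPow n (t.realize v)) (t.realize v) := rfl
    rw [h1, h2, realize_tMul, ih]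

/-- An isomorphism of structures from a bijection that preserves the operations. -/
def equivOfHom {M N : Type} [groupLang.Structure M] [groupLang.Structure N] (f : M ≃ N)
    (h1 : f (sOne M) = sOne N) (hi : ∀ a, f (sInv a) = sInv (f a))
    (hm : ∀ a b, f (sMul a b) = sMul (f a) (f b)) : M ≃[groupLang] N where
  toEquiv := f
  map_fun' := by
    intro n g x
    match n, g, x with
    | 0, GroupFunc.one, x => rw [funMap_one, funMap_one]; exact h1
    | 1, GroupFunc.inv, x => rw [funMap_inv, funMap_inv]; exact hi _
    | 2, GroupFunc.mul, x => rw [funMap_mul, funMap_mul]; exact hm _ _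
  map_rel' := fun r => nomatch r

section Equiv

variable {M N : Type} [groupLang.Structure M] [groupLang.Structure N] (f : M ≃[groupLang] N)

theorem equiv_sMul (a b : M) : f (sMul a b) = sMul (f a) (f b) :=
  (f.map_fun _ _).trans (funMap_mul _)

end Equiv

/-- A literal, given by its sign and the two sides of the equation. -/
abbrev Literal (α : Type) : Type := Bool × groupLang.Term α × groupLang.Term α

/-! ### Literals and their Gödel numbers -/

namespace Literal

/-- Truth of a literal. -/
def Holds (l : Literal α) (v : α → M) : Prop :=
  if l.1 then l.2.1.realize v = l.2.2.realize v else l.2.1.realize v ≠ l.2.2.realize v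

/-- The change of the variables of a literal. -/
def relabel (f : α → β) (l : Literal α) : Literal β := (l.1, l.2.1.relabel f, l.2.2.relabel f)

/-- A literal as a quantifier-free formula. -/
def toQF (l : Literal ℕ) : QF := .lit l.1 l.2.1 l.2.2

theorem holds_relabel (f : α → β) (l : Literal α) (v : β → M) :
    (l.relabel f).Holds v ↔ l.Holds (v ∘ f) := by
  simp [Holds, relabel]

theorem realize_toQF (l : Literal ℕ) (v : ℕ → M) : l.toQF.Realize v ↔ l.Holds v := by
  obtain ⟨b, s, t⟩ := l
  cases b <;> simp [toQF, QF.Realize, Holds]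

theorem code_toQF (l : Literal ℕ) :
    l.toQF.code = 4 * Nat.pair (termCode l.2.1) (termCode l.2.2) + bif l.1 then 1 else 0 := by
  obtain ⟨b, s, t⟩ := l
  cases b <;> simp [toQF, QF.code]

theorem toQF_code_injective {l l' : Literal ℕ} (h : l.toQF.code = l'.toQF.code) : l = l' := by
  have := congrArg QF.ofCode h
  rw [QF.ofCode_code, QF.ofCode_code] at this
  simp only [toQF, QF.lit.injEq] at this
  exact Prod.ext this.1 (Prod.ext this.2.1 this.2.2)

@[fun_prop] theorem computable_code {f : σ → Literal ℕ} (hf : Computable f) :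
    Computable fun a => (f a).toQF.code := by
  simp only [code_toQF]
  fun_prop

theorem mem_diagram_iff {U : Set ℕ} [groupLang.Structure U] {n : ℕ} :
    n ∈ diagram U ↔ ∃ l : Literal U, l.Holds (id : U → U) ∧ n = (l.relabel Subtype.val).toQF.code := by
  constructor
  · rintro ⟨s, t, ⟨h, rfl⟩ | ⟨h, rfl⟩⟩
    · exact ⟨(true, s, t), by simpa [Holds] using h, rfl⟩
    · exact ⟨(false, s, t), by simpa [Holds] using h, rfl⟩
  · rintro ⟨⟨b, s, t⟩, h, rfl⟩
    cases b
    · exact ⟨s, t, .inr ⟨by simpa [Holds] using h, rfl⟩⟩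
    · exact ⟨s, t, .inl ⟨by simpa [Holds] using h, rfl⟩⟩

/-- Relabelling along the left inverse `Function.invFun f`, which needs a nonempty domain, undoes
relabelling along `f`. -/
theorem relabel_injective [Nonempty α] {f : α → β} (hf : Function.Injective f) :
    Function.Injective (relabel f : Literal α → Literal β) := by
  rintro ⟨b, s, t⟩ ⟨b', s', t'⟩ h
  have ht : Function.Injective (Language.Term.relabel (L := groupLang) f) := by
    intro s t h
    have := congrArg (Language.Term.relabel (Function.invFun f)) h
    simpa [Language.Term.relabel_relabel, Function.invFun_comp hf] using this
  simp only [relabel, Prod.mk.injEq] at h ⊢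
  exact ⟨h.1, ht h.2.1, ht h.2.2⟩

theorem code_mem_diagram_iff {U : Set ℕ} [groupLang.Structure U] (l : Literal U) :
    (l.relabel Subtype.val).toQF.code ∈ diagram U ↔ l.Holds (id : U → U) := by
  have : Nonempty U := ⟨sOne U⟩
  rw [mem_diagram_iff]
  constructor
  · rintro ⟨l', h, e⟩
    rwa [relabel_injective Subtype.val_injective (toQF_code_injective e)]
  · exact fun h => ⟨l, h, rfl⟩

end Literal

end Terms

/-! ### Axioms for a subgroup of the rationals with a distinguished element -/

/-- The rational number coded by a triple of natural numbers. -/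
def rat (t : ℕ × ℕ × ℕ) : ℚ := ((t.1 : ℚ) - t.2.1) / (t.2.2 + 1)

theorem exists_rat_eq (q : ℚ) : ∃ t, rat t = q := by
  refine ⟨(q.num.toNat, (-q.num).toNat, q.den - 1), ?_⟩
  have h1 : ((q.num.toNat : ℚ) - ((-q.num).toNat : ℚ)) = q.num := by
    have := Int.toNat_sub_toNat_neg q.num
    exact_mod_cast this
  have h2 : ((q.den - 1 : ℕ) : ℚ) + 1 = q.den := by
    have := q.den_pos
    rw [← Nat.cast_add_one, Nat.sub_add_cancel this]
  simp only [rat, h1, h2, Rat.num_div_den]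

/-- Cleared of division and subtraction, the relation becomes an equation between products of
natural powers, which the language of groups can express. -/
theorem rat_eq_iff {t : ℕ × ℕ × ℕ} {q : ℚ} : rat t = q ↔ (t.2.2 + 1) * q + t.2.1 = t.1 := by
  have : (t.2.2 : ℚ) + 1 ≠ 0 := by positivity
  rw [rat, div_eq_iff this]
  constructor <;> intro h <;> linarith

section Clauses

variable {α β : Type}

/-- The literals in the axioms of the structures `(A, x)`, where `A` is a subgroup of the rationals
enumerated by `E` and `x = 1`. The axioms state that for all `i`, `a`, `b` and `c` there are `j` and
`d` for which the literal is true. -/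
def clause (E : ℕ → ℕ × ℕ × ℕ) (i j : ℕ) (x a b c d : α) : Literal α :=
  bif i.unpair.1 == 0 then
    (true, tMul (tMul (.var a) (.var b)) (.var c), tMul (.var a) (tMul (.var b) (.var c)))
  else bif i.unpair.1 == 1 then (true, tMul tOne (.var a), .var a)
  else bif i.unpair.1 == 2 then (true, tMul (tInv (.var a)) (.var a), tOne)
  else bif i.unpair.1 == 3 then (true, tMul (.var a) (.var b), tMul (.var b) (.var a))
  else bif i.unpair.1 == 4 then (false, .var x, tOne)
  -- Torsion-freeness is an implication; `j` selects its negated hypothesis or its conclusion.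
  else bif i.unpair.1 == 5 then
    bif j == 0 then (false, tPow (i.unpair.2 + 1) (.var a), tOne) else (true, .var a, tOne)
  -- Here `d` is `rat (E k)` times `x`, where `k = i.unpair.2`.
  else bif i.unpair.1 == 6 then
    (true, tMul (tPow ((E i.unpair.2).2.2 + 1) (.var d)) (tPow (E i.unpair.2).2.1 (.var x)),
      tPow (E i.unpair.2).1 (.var x))
  -- All remaining `i` express rank one: `j` locates in the list the rational whose multiple of `x`
  -- is `a`.
  else (true, tMul (tPow ((E j).2.2 + 1) (.var a)) (tPow (E j).2.1 (.var x)), tPow (E j).1 (.var x))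

theorem relabel_clause (E : ℕ → ℕ × ℕ × ℕ) (i j : ℕ) (x a b c d : α) (f : α → β) :
    (clause E i j x a b c d).relabel f = clause E i j (f x) (f a) (f b) (f c) (f d) := by
  have : ∀ (b : Bool) (l l' : Literal α),
      (bif b then l else l').relabel f = bif b then l.relabel f else l'.relabel f := by
    intro b l l'; cases b <;> rfl
  simp only [clause, this]
  simp only [Literal.relabel, relabel_tMul, relabel_tOne, relabel_tInv, relabel_tPow,
    Language.Term.relabel]

theorem computable_clause {E : ℕ → ℕ × ℕ × ℕ} (hE : Computable E) {σ : Type*} [Primcodable σ]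
    {i j x a b c d : σ → ℕ} (hi : Computable i) (hj : Computable j) (hx : Computable x)
    (ha : Computable a) (hb : Computable b) (hc : Computable c) (hd : Computable d) :
    Computable fun s => clause E (i s) (j s) (x s) (a s) (b s) (c s) (d s) := by
  unfold clause
  fun_prop

variable {M N : Type} [groupLang.Structure M] [groupLang.Structure N]

/-- The axioms of the structures `(A, 1)`, where `A` is a subgroup of the rationals that is
enumerated by `E`. -/
def IsModel (E : ℕ → ℕ × ℕ × ℕ) (x : M) : Prop :=
  ∀ i, ∀ a b c : M, ∃ j, ∃ d : M, (clause E i j x a b c d).Holds id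

theorem holds_equiv (f : M ≃[groupLang] N) (l : Literal α) (v : α → M) :
    l.Holds (f ∘ v) ↔ l.Holds v := by
  simp [Literal.Holds]

theorem IsModel.map {E : ℕ → ℕ × ℕ × ℕ} {x : M} (h : IsModel E x) (f : M ≃[groupLang] N) :
    IsModel E (f x) := by
  intro i a b c
  obtain ⟨j, d, hd⟩ := h i (f.symm a) (f.symm b) (f.symm c)
  refine ⟨j, f d, ?_⟩
  have := (holds_equiv f _ _).2 hd
  rw [Function.comp_id] at this
  change (clause E i j x _ _ _ d).Holds (id ∘ f) at this
  rw [← Literal.holds_relabel, relabel_clause] at this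
  simpa using this

/-- The axioms of the structures `(A, 1)` in unfolded form. -/
structure RankOne (E : ℕ → ℕ × ℕ × ℕ) (x : M) : Prop where
  assoc (a b c : M) : sMul (sMul a b) c = sMul a (sMul b c)
  one_mul (a : M) : sMul (sOne M) a = a
  inv_mul (a : M) : sMul (sInv a) a = sOne M
  comm (a b : M) : sMul a b = sMul b a
  ne_one : x ≠ sOne M
  torsion (n : ℕ) (a : M) : sPow (n + 1) a = sOne M → a = sOne M
  divides (n : ℕ) : ∃ d, sMul (sPow ((E n).2.2 + 1) d) (sPow (E n).2.1 x) = sPow (E n).1 x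
  rank (a : M) : ∃ n, sMul (sPow ((E n).2.2 + 1) a) (sPow (E n).2.1 x) = sPow (E n).1 x

theorem isModel_iff {E : ℕ → ℕ × ℕ × ℕ} {x : M} : IsModel E x ↔ RankOne E x := by
  constructor
  · intro h
    have hne : Nonempty M := ⟨x⟩
    refine ⟨fun a b c => ?_, fun a => ?_, fun a => ?_, fun a b => ?_, ?_, fun n a => ?_, fun n => ?_,
      fun a => ?_⟩
    · simpa [clause, Literal.Holds, hne] using h (Nat.pair 0 0) a b c
    · simpa [clause, Literal.Holds, hne] using h (Nat.pair 1 0) a a a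
    · simpa [clause, Literal.Holds, hne] using h (Nat.pair 2 0) a a a
    · simpa [clause, Literal.Holds, hne] using h (Nat.pair 3 0) a b a
    · simpa [clause, Literal.Holds, hne] using h (Nat.pair 4 0) x x x
    · obtain ⟨j, d, hd⟩ := h (Nat.pair 5 n) a a a
      rcases j with _ | j
      · intro h0
        simp [clause, Literal.Holds, h0] at hd
      · intro _
        simpa [clause, Literal.Holds] using hd
    · simpa [clause, Literal.Holds] using h (Nat.pair 6 n) x x x
    · simpa [clause, Literal.Holds, hne] using h (Nat.pair 7 0) a a a
  · intro h i a b c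
    by_cases h0 : i.unpair.1 = 0
    · exact ⟨0, x, by simpa [clause, Literal.Holds, h0] using h.assoc a b c⟩
    by_cases h1 : i.unpair.1 = 1
    · exact ⟨0, x, by simpa [clause, Literal.Holds, h1] using h.one_mul a⟩
    by_cases h2 : i.unpair.1 = 2
    · exact ⟨0, x, by simpa [clause, Literal.Holds, h2] using h.inv_mul a⟩
    by_cases h3 : i.unpair.1 = 3
    · exact ⟨0, x, by simpa [clause, Literal.Holds, h3] using h.comm a b⟩
    by_cases h4 : i.unpair.1 = 4
    · exact ⟨0, x, by simpa [clause, Literal.Holds, h4] using h.ne_one⟩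
    by_cases h5 : i.unpair.1 = 5
    · by_cases ha : sPow (i.unpair.2 + 1) a = sOne M
      · exact ⟨1, x, by simpa [clause, Literal.Holds, h5] using h.torsion _ _ ha⟩
      · exact ⟨0, x, by simpa [clause, Literal.Holds, h5] using ha⟩
    by_cases h6 : i.unpair.1 = 6
    · obtain ⟨d, hd⟩ := h.divides i.unpair.2
      exact ⟨0, d, by simpa [clause, Literal.Holds, h6] using hd⟩
    · obtain ⟨j, hj⟩ := h.rank a
      refine ⟨j, x, ?_⟩
      simp only [clause, beq_false_of_ne h0, beq_false_of_ne h1, beq_false_of_ne h2,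
        beq_false_of_ne h3, beq_false_of_ne h4, beq_false_of_ne h5, beq_false_of_ne h6, cond_false]
      simpa [Literal.Holds] using hj

/-- The group given by the axioms. -/
abbrev RankOne.group {E : ℕ → ℕ × ℕ × ℕ} {x : M} (h : RankOne E x) : AddCommGroup M where
  add := sMul
  zero := sOne M
  neg := sInv
  nsmul := sPow
  zsmul := letI : Zero M := ⟨sOne M⟩; letI : Add M := ⟨sMul⟩; letI : Neg M := ⟨sInv⟩; zsmulRec sPow
  add_assoc := h.assoc
  zero_add := h.one_mul
  add_zero a := (h.comm _ _).trans (h.one_mul a)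
  neg_add_cancel := h.inv_mul
  add_comm := h.comm

theorem sPow_eq (A : AddSubgroup ℚ) (n : ℕ) (a : A) : sPow n a = n • a := by
  induction n with
  | zero => exact (zero_nsmul a).symm
  | succ n ih =>
    have h2 : sPow (n + 1) a = sMul (sPow n a) a := rfl
    rw [h2, ih, succ_nsmul]; rfl

theorem rankOne_one {E : ℕ → ℕ × ℕ × ℕ} {R : AddSubgroup ℚ} (h1 : (1 : ℚ) ∈ R)
    (hE : ∀ q, q ∈ R ↔ ∃ n, rat (E n) = q) : RankOne E (⟨1, h1⟩ : R) := by
  have key : ∀ (n : ℕ) (d : R), rat (E n) = d →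
      sMul (sPow ((E n).2.2 + 1) d) (sPow (E n).2.1 (⟨1, h1⟩ : R)) = sPow (E n).1 ⟨1, h1⟩ := by
    intro n d hd
    simp only [sPow_eq]
    apply Subtype.ext
    rw [rat_eq_iff] at hd
    change ((E n).2.2 + 1) • (d : ℚ) + (E n).2.1 • (1 : ℚ) = (E n).1 • (1 : ℚ)
    simpa using hd
  refine ⟨fun a b c => add_assoc a b c, fun a => zero_add a, fun a => neg_add_cancel a,
    fun a b => add_comm a b, fun h => ?_, fun n a h => ?_, fun n => ?_, fun a => ?_⟩
  · exact one_ne_zero (congrArg Subtype.val h)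
  · rw [sPow_eq] at h
    exact (smul_eq_zero.1 (congrArg Subtype.val h)).elim (fun h => by simp at h)
      fun h => Subtype.ext h
  · exact ⟨⟨rat (E n), (hE _).2 ⟨n, rfl⟩⟩, key n _ rfl⟩
  · obtain ⟨n, hn⟩ := (hE a).1 a.2
    exact ⟨n, key n a hn⟩

/-- Each element is sent to its ratio to `x`. The axiom `rank` puts the ratio in `R`, `divides`
makes the map onto, and torsion-freeness with `x ≠ 0` makes it well defined and injective. -/
theorem RankOne.nonempty_equiv {E : ℕ → ℕ × ℕ × ℕ} {R : AddSubgroup ℚ}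
    (hE : ∀ q, q ∈ R ↔ ∃ n, rat (E n) = q) {x : M} (h : RankOne E x) :
    Nonempty (M ≃[groupLang] R) := by
  let := h.group
  have tf : ∀ (n : ℤ) (a : M), n • a = 0 → n = 0 ∨ a = 0 := by
    have tf' : ∀ (n : ℕ) (a : M), n • a = 0 → n = 0 ∨ a = 0 := by
      rintro (_ | n) a ha
      · exact .inl rfl
      · exact .inr (h.torsion n a ha)
    intro n a ha
    obtain ⟨m, rfl | rfl⟩ := n.eq_nat_or_neg
    · exact (tf' m a (by simpa using ha)).imp_left (by simp)
    · exact (tf' m a (by simpa using ha)).imp_left (by simp)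
  have cancel : ∀ (n : ℤ) (a b : M), n ≠ 0 → n • a = n • b → a = b := by
    intro n a b hn hab
    exact sub_eq_zero.1 ((tf n (a - b) (by rw [zsmul_sub, hab, sub_self])).resolve_left hn)
  have cancel' : ∀ m n : ℤ, m • x = n • x → m = n := by
    intro m n hmn
    exact sub_eq_zero.1 ((tf (m - n) x (by rw [sub_zsmul, hmn, add_neg_cancel])).resolve_right h.ne_one)
  have hrel : ∀ (n : ℕ) (y : M), sMul (sPow ((E n).2.2 + 1) y) (sPow (E n).2.1 x) = sPow (E n).1 x →
      (((E n).2.2 + 1 : ℕ) : ℤ) • y = (((E n).1 : ℤ) - (E n).2.1) • x := by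
    intro n y hy
    -- Sums and natural multiples of `h.group` are `sMul` and `sPow` by definition, so the axiom is
    -- reread without change.
    have : ((E n).2.2 + 1) • y + (E n).2.1 • x = (E n).1 • x := hy
    rw [sub_zsmul, natCast_zsmul, natCast_zsmul, natCast_zsmul, ← this, add_neg_cancel_right]
  have hval : ∀ n : ℕ, rat (E n) = (((E n).1 : ℤ) - (E n).2.1 : ℤ) / (((E n).2.2 + 1 : ℕ) : ℤ) := by
    intro n; simp [rat]
  -- `Rel y q` expresses `y = q x` without dividing in `M`: some fraction `m / n` equal to `q`
  -- satisfies `n y = m x`.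
  let Rel (y : M) (q : ℚ) : Prop := ∃ m n : ℤ, n ≠ 0 ∧ n • y = m • x ∧ q = m / n
  have rel_inj : ∀ {y y' q}, Rel y q → Rel y' q → y = y' := by
    rintro y y' q ⟨m, n, hn, hy, hq⟩ ⟨m', n', hn', hy', hq'⟩
    have : m * n' = m' * n := by
      have h1 : (n : ℚ) ≠ 0 := by exact_mod_cast hn
      have h2 : (n' : ℚ) ≠ 0 := by exact_mod_cast hn'
      have h3 := hq.symm.trans hq'
      rw [div_eq_div_iff h1 h2] at h3
      exact_mod_cast h3
    refine cancel (n * n') _ _ (mul_ne_zero hn hn') ?_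
    rw [mul_comm, mul_smul, hy, mul_comm, mul_smul, hy', ← mul_smul, ← mul_smul, mul_comm n', this,
      mul_comm n]
  have rel_fun : ∀ {y q q'}, Rel y q → Rel y q' → q = q' := by
    rintro y q q' ⟨m, n, hn, hy, rfl⟩ ⟨m', n', hn', hy', rfl⟩
    have h1 : (n : ℚ) ≠ 0 := by exact_mod_cast hn
    have h2 : (n' : ℚ) ≠ 0 := by exact_mod_cast hn'
    rw [div_eq_div_iff h1 h2]
    have : n' * m = n * m' := cancel' _ _ (by
      rw [mul_smul, ← hy, mul_smul, ← hy', ← mul_smul, ← mul_smul, mul_comm])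
    have : m * n' = m' * n := by linarith
    exact_mod_cast this
  have rel_add : ∀ {y y' q q'}, Rel y q → Rel y' q' → Rel (y + y') (q + q') := by
    rintro y y' q q' ⟨m, n, hn, hy, rfl⟩ ⟨m', n', hn', hy', rfl⟩
    have h1 : (n : ℚ) ≠ 0 := by exact_mod_cast hn
    have h2 : (n' : ℚ) ≠ 0 := by exact_mod_cast hn'
    refine ⟨m * n' + n * m', n * n', mul_ne_zero hn hn', ?_, ?_⟩
    · rw [zsmul_add, mul_smul n n' y', hy', mul_comm, mul_smul n' n y, hy, add_zsmul, mul_comm m,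
        mul_smul, mul_smul]
    · rw [div_add_div _ _ h1 h2]; push_cast; ring
  have exR : ∀ y : M, ∃ q : R, Rel y q := by
    intro y
    obtain ⟨n, hn⟩ := h.rank y
    exact ⟨⟨rat (E n), (hE _).2 ⟨n, rfl⟩⟩, _, _, by positivity, hrel n y hn, hval n⟩
  choose f hf using exR
  have hbij : Function.Bijective f := by
    constructor
    · intro y y' e
      exact rel_inj (hf y) (e ▸ hf y')
    · rintro ⟨q, hq⟩
      obtain ⟨n, rfl⟩ := (hE q).1 hq
      obtain ⟨d, hd⟩ := h.divides n
      exact ⟨d, Subtype.ext (rel_fun (hf d) ⟨_, _, by positivity, hrel n d hd, hval n⟩)⟩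
  have hadd : ∀ y y', f (y + y') = f y + f y' := fun y y' =>
    Subtype.ext (rel_fun (hf _) (rel_add (hf y) (hf y')))
  let F : M →+ R := AddMonoidHom.mk' f hadd
  exact ⟨equivOfHom (Equiv.ofBijective f hbij) (map_zero F) (map_neg F) (map_add F)⟩

/-- A structure is isomorphic to a subgroup of the rationals that contains `1` if and only if it
satisfies the axioms for some element. -/
theorem nonempty_equiv_iff {E : ℕ → ℕ × ℕ × ℕ} {R : AddSubgroup ℚ} (h1 : (1 : ℚ) ∈ R)
    (hE : ∀ q, q ∈ R ↔ ∃ n, rat (E n) = q) :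
    Nonempty (M ≃[groupLang] R) ↔ ∃ x : M, IsModel E x := by
  constructor
  · rintro ⟨f⟩
    exact ⟨_, (isModel_iff.2 (rankOne_one h1 hE)).map f.symm⟩
  · rintro ⟨x, hx⟩
    exact (isModel_iff.1 hx).nonempty_equiv hE

end Clauses

/-! ### The Scott sentence -/

/-- Supplies indices for disjunctions and conjunctions whose members are given by a computable
sequence, uniformly in a parameter. -/
theorem exists_W_eq_range {δ : Type*} [Primcodable δ] {t : ℕ → ℕ → δ}
    (ht : Computable fun p : ℕ × ℕ => t p.1 p.2) :
    ∃ g : ℕ → ℕ, Computable g ∧ ∀ a m, m ∈ W (g a) ↔ ∃ k, Encodable.encode (t a k) = m := by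
  apply exists_W_eq (P := fun p => ∃ k, Encodable.encode (t p.1 k) = p.2)
  refine IsSigma01.ex (P := fun (p : ℕ × ℕ) k => Encodable.encode (t p.1 k) = p.2) ?_
  refine IsSigma01.of_computable
    (f := fun q : (ℕ × ℕ) × ℕ => Encodable.encode (t q.1.1 q.2) == q.1.2) ?_ (fun q => by simp)
  have : Computable fun q : (ℕ × ℕ) × ℕ => t q.1.1 q.2 :=
    ht.comp (g := fun q : (ℕ × ℕ) × ℕ => (q.1.1, q.2)) (by fun_prop)
  fun_prop

/-- When `W e` is the range of a sequence of triples of level at most `n`, the level test and the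
truncation `min` in `formulaOfIndex` have no effect. -/
theorem realize_sigma_succ {n e : ℕ} {t : ℕ → ℕ × List ℕ × ℕ}
    (hW : ∀ m, m ∈ W e ↔ ∃ k, Encodable.encode (t k) = m) (ht : ∀ k, (t k).1 ≤ n)
    {M : Type} [groupLang.Structure M] (v : ℕ → M) :
    (formulaOfIndex (n + 1) true e).Realize v ↔
      ∃ k, ((t k).2.1.foldr InfFormula.ex (formulaOfIndex (t k).1 false (t k).2.2)).Realize v := by
  rw [formulaOfIndex]
  constructor
  · rintro ⟨i, ⟨hi, -⟩, h⟩
    obtain ⟨k, rfl⟩ := (hW i).1 hi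
    exact ⟨k, by simpa only [Denumerable.ofNat_encode, min_eq_left (ht k)] using h⟩
  · rintro ⟨k, h⟩
    exact ⟨Encodable.encode (t k), ⟨(hW _).2 ⟨k, rfl⟩, by
      simpa only [Denumerable.ofNat_encode] using Nat.lt_succ_of_le (ht k)⟩,
      by simpa only [Denumerable.ofNat_encode, min_eq_left (ht k)] using h⟩

theorem realize_pi_succ {n e : ℕ} {t : ℕ → ℕ × List ℕ × ℕ}
    (hW : ∀ m, m ∈ W e ↔ ∃ k, Encodable.encode (t k) = m) (ht : ∀ k, (t k).1 ≤ n)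
    {M : Type} [groupLang.Structure M] (v : ℕ → M) :
    (formulaOfIndex (n + 1) false e).Realize v ↔
      ∀ k, ((t k).2.1.foldr InfFormula.all (formulaOfIndex (t k).1 true (t k).2.2)).Realize v := by
  rw [formulaOfIndex]
  constructor
  · intro h k
    simpa only [Denumerable.ofNat_encode, min_eq_left (ht k)] using h (Encodable.encode (t k))
      ⟨(hW _).2 ⟨k, rfl⟩, by
      simpa only [Denumerable.ofNat_encode] using Nat.lt_succ_of_le (ht k)⟩
  · rintro h i ⟨hi, -⟩
    obtain ⟨k, rfl⟩ := (hW i).1 hi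
    simpa only [Denumerable.ofNat_encode, min_eq_left (ht k)] using h k

theorem freeVars_succ_subset {n e : ℕ} {b : Bool} {t : ℕ → ℕ × List ℕ × ℕ} {s : Set ℕ}
    (hW : ∀ m, m ∈ W e ↔ ∃ k, Encodable.encode (t k) = m) (ht : ∀ k, (t k).1 ≤ n)
    (h : ∀ k, (formulaOfIndex (t k).1 (!b) (t k).2.2).freeVars ⊆ {x | x ∈ (t k).2.1} ∪ s) :
    (formulaOfIndex (n + 1) b e).freeVars ⊆ s := by
  have hex : ∀ (l : List ℕ) (φ : InfFormula),
      (l.foldr InfFormula.ex φ).freeVars = φ.freeVars \ {x | x ∈ l} := by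
    intro l φ
    induction l with
    | nil => simp
    | cons a l ih => ext x; simp [InfFormula.freeVars, ih]; tauto
  have hall : ∀ (l : List ℕ) (φ : InfFormula),
      (l.foldr InfFormula.all φ).freeVars = φ.freeVars \ {x | x ∈ l} := by
    intro l φ
    induction l with
    | nil => simp
    | cons a l ih => ext x; simp [InfFormula.freeVars, ih]; tauto
  cases b
  · rw [formulaOfIndex, InfFormula.freeVars]
    refine Set.iUnion₂_subset fun i hi => ?_
    obtain ⟨k, rfl⟩ := (hW i).1 hi.1
    simp only [Denumerable.ofNat_encode, min_eq_left (ht k), hall]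
    exact Set.sdiff_subset_iff.2 (h k)
  · rw [formulaOfIndex, InfFormula.freeVars]
    refine Set.iUnion₂_subset fun i hi => ?_
    obtain ⟨k, rfl⟩ := (hW i).1 hi.1
    simp only [Denumerable.ofNat_encode, min_eq_left (ht k), hex]
    exact Set.sdiff_subset_iff.2 (h k)

theorem varFinset_relabel_subset {α β : Type} [DecidableEq β] (f : α → β)
    (t : groupLang.Term α) : ((t.relabel f).varFinset : Set β) ⊆ Set.range f := by
  induction t using term_induction with
  | hvar a => simp [Language.Term.relabel, Language.Term.varFinset]
  | hone => simp [tOne, Language.Term.varFinset]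
  | hinv t ih => simpa [relabel_tInv, tInv, Language.Term.varFinset] using ih
  | hmul s t hs ht =>
    simpa [relabel_tMul, tMul, Language.Term.varFinset] using ⟨hs, ht⟩

/-- The groups that are isomorphic to a subgroup of the rationals with a computable enumeration
have a computable `Σ₃` Scott sentence. -/
theorem exists_scottSentence {A : Type} [groupLang.Structure A] {E : ℕ → ℕ × ℕ × ℕ}
    (hE : Computable E)
    (h : ∀ (M : Type) [groupLang.Structure M],
      Nonempty (M ≃[groupLang] A) ↔ ∃ x : M, IsModel E x) :
    ∃ φ : InfFormula, IsComputableSigma 3 φ ∧ φ.IsScottSentence A := by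
  -- Variable `0` stands for `x`, variables `1`, `2`, `3` for the universally quantified elements,
  -- and `4` for the witness `d`. The `Σ₁` formula with index `g i` is the disjunction over `j`.
  obtain ⟨g, hg, hW1⟩ := exists_W_eq_range
    (t := fun i j => (0, [4], (clause E i j 0 1 2 3 4).toQF.code)) (by
      have : Computable fun p : ℕ × ℕ => clause E p.1 p.2 0 1 2 3 4 :=
        computable_clause hE (by fun_prop) (by fun_prop) (by fun_prop) (by fun_prop) (by fun_prop)
          (by fun_prop) (by fun_prop)
      fun_prop)
  -- The `Π₂` conjunction over all `i`; below it the quantifier over `x` is added, with a single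
  -- disjunct.
  obtain ⟨e2, -, hW2⟩ := exists_W_eq_range (t := fun _ i => (1, [1, 2, 3], g i)) (by fun_prop)
  obtain ⟨e3, -, hW3⟩ := exists_W_eq_range (t := fun _ _ => (2, [0], e2 0)) (by fun_prop)
  refine ⟨formulaOfIndex 3 true (e3 0), ⟨_, rfl⟩, ?_, ?_⟩
  · refine Set.subset_empty_iff.1 (freeVars_succ_subset (hW3 0) (fun _ => le_rfl) fun _ => ?_)
    refine freeVars_succ_subset (hW2 0) (fun _ => le_rfl) fun i => ?_
    refine freeVars_succ_subset (hW1 i) (fun _ => le_rfl) fun j => ?_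
    simp only [formulaOfIndex, QF.ofCode_code, InfFormula.freeVars]
    -- Written as a relabelling from `Fin 5`, the clause visibly has no variables beyond `0, ...,
    -- 4`.
    have hc : clause E i j 0 1 2 3 4 =
        (clause E i j (0 : Fin 5) 1 2 3 4).relabel (Fin.val : Fin 5 → ℕ) := by
      rw [relabel_clause]; rfl
    rw [hc]
    refine (Set.union_subset (varFinset_relabel_subset _ _)
      (varFinset_relabel_subset _ _)).trans ?_
    rintro _ ⟨k, rfl⟩
    fin_cases k <;> simp
  · intro M _ _
    rw [h]
    have key : ∀ v : ℕ → M,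
        (formulaOfIndex 3 true (e3 0)).Realize v ↔ ∃ x : M, IsModel E x := by
      intro v
      rw [realize_sigma_succ (hW3 0) (fun _ => le_rfl)]
      simp only [List.foldr_cons, List.foldr_nil, InfFormula.Realize, exists_const]
      refine exists_congr fun x => ?_
      rw [realize_pi_succ (hW2 0) (fun _ => le_rfl)]
      simp only [List.foldr_cons, List.foldr_nil, InfFormula.Realize]
      refine forall_congr' fun i => forall_congr' fun a => forall_congr' fun b =>
        forall_congr' fun c => ?_
      rw [realize_sigma_succ (hW1 i) (fun _ => le_rfl)]
      simp only [List.foldr_cons, List.foldr_nil, InfFormula.Realize]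
      refine exists_congr fun j => exists_congr fun d => ?_
      rw [formulaOfIndex, QF.ofCode_code, InfFormula.Realize, Literal.realize_toQF]
      -- The assignment itself serves as a relabelling of the variables by elements of `M`, which
      -- turns the clause into the one in `IsModel`.
      rw [← Function.id_comp (Function.update _ 4 d), ← Literal.holds_relabel, relabel_clause]
      simp [Function.update]
    constructor
    · exact fun hM => (key _).1 (hM fun _ => sOne M)
    · exact fun hx v => (key v).2 hx

/-! ### Atomic diagrams -/

section Diagrams

/-- The structure for the language of groups with the given operations. -/
abbrev structureOf {M : Type} (one : M) (inv : M → M) (mul : M → M → M) :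
    groupLang.Structure M where
  funMap := fun {_} f =>
    match f with
    | GroupFunc.one => fun _ => one
    | GroupFunc.inv => fun a => inv (a 0)
    | GroupFunc.mul => fun a => mul (a 0) (a 1)
  RelMap := fun {_} r => nomatch r

variable {M : Type} [groupLang.Structure M]

/-- The operations of a structure, extended to `Option` so that they are undefined when an argument
is. -/
instance optionStructure : groupLang.Structure (Option M) :=
  structureOf (some (sOne M)) (Option.map sInv) (Option.map₂ sMul)

theorem sOne_option : sOne (Option M) = some (sOne M) := rfl

theorem sInv_option (a : Option M) : sInv a = a.map sInv := rfl

theorem sMul_option (a b : Option M) : sMul a b = Option.map₂ sMul a b := rfl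

/-! ### Values of terms with numerical constants, and membership in diagrams -/

variable {U : Set ℕ} [groupLang.Structure U]

open Classical in
/-- The value of a term whose constants are natural numbers, if all of them belong to `U`. -/
noncomputable def evalIn (U : Set ℕ) [groupLang.Structure U] (t : groupLang.Term ℕ) : Option U :=
  t.realize fun i => if h : i ∈ U then some ⟨i, h⟩ else none

theorem evalIn_var {i : ℕ} {a : U} : evalIn U (.var i) = some a ↔ i = a := by
  by_cases h : i ∈ U
  · simp [evalIn, h, Subtype.ext_iff]
  · simp only [evalIn, Language.Term.realize_var, h, dite_false, reduceCtorEq, false_iff]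
    rintro rfl
    exact h a.2

theorem evalIn_tOne : evalIn U tOne = some (sOne U) := by
  rw [evalIn, realize_tOne, sOne_option]

theorem evalIn_tInv (t : groupLang.Term ℕ) : evalIn U (tInv t) = (evalIn U t).map sInv := by
  rw [evalIn, realize_tInv, sInv_option]; rfl

theorem evalIn_tMul (s t : groupLang.Term ℕ) :
    evalIn U (tMul s t) = Option.map₂ sMul (evalIn U s) (evalIn U t) := by
  rw [evalIn, realize_tMul, sMul_option]; rfl

theorem evalIn_relabel (t : groupLang.Term U) :
    evalIn U (t.relabel Subtype.val) = some (t.realize id) := by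
  induction t using term_induction with
  | hvar a => exact evalIn_var.2 rfl
  | hone => rw [relabel_tOne, evalIn_tOne, realize_tOne]
  | hinv t ih => rw [relabel_tInv, evalIn_tInv, realize_tInv, ih, Option.map_some]
  | hmul s t hs ht => rw [relabel_tMul, evalIn_tMul, realize_tMul, hs, ht, Option.map₂_some_some]

/-- Undefinedness propagates through the operations, so a term with a value has all its constants in
`U`. -/
theorem exists_relabel_eq {t : groupLang.Term ℕ} {a : U} (h : evalIn U t = some a) :
    ∃ t' : groupLang.Term U, t'.relabel Subtype.val = t ∧ t'.realize id = a := by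
  suffices ∃ t' : groupLang.Term U, t'.relabel Subtype.val = t by
    obtain ⟨t', rfl⟩ := this
    rw [evalIn_relabel, Option.some_inj] at h
    exact ⟨t', rfl, h⟩
  induction t using term_induction generalizing a with
  | hvar i => exact ⟨.var a, by rw [evalIn_var.1 h]; rfl⟩
  | hone => exact ⟨tOne, relabel_tOne _⟩
  | hinv t ih =>
    rw [evalIn_tInv, Option.map_eq_some_iff] at h
    obtain ⟨b, hb, -⟩ := h
    obtain ⟨t', rfl⟩ := ih hb
    exact ⟨tInv t', relabel_tInv _ _⟩
  | hmul s t hs ht =>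
    rw [evalIn_tMul, Option.map₂_eq_some_iff] at h
    obtain ⟨b, c, hb, hc, -⟩ := h
    obtain ⟨s', rfl⟩ := hs hb
    obtain ⟨t', rfl⟩ := ht hc
    exact ⟨tMul s' t', relabel_tMul _ _ _⟩

theorem toQF_code_mem_diagram {l : Literal ℕ} :
    l.toQF.code ∈ diagram U ↔ ∃ a b, evalIn U l.2.1 = some a ∧ evalIn U l.2.2 = some b ∧
      (l.1 = true ↔ a = b) := by
  rw [Literal.mem_diagram_iff]
  constructor
  · rintro ⟨⟨b, s, t⟩, h, e⟩
    rw [Literal.toQF_code_injective e]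
    refine ⟨_, _, evalIn_relabel s, evalIn_relabel t, ?_⟩
    cases b <;> simpa [Literal.Holds, Literal.relabel] using h
  · obtain ⟨b, s, t⟩ := l
    rintro ⟨x, y, hx, hy, h⟩
    obtain ⟨s', rfl, rfl⟩ := exists_relabel_eq hx
    obtain ⟨t', rfl, rfl⟩ := exists_relabel_eq hy
    refine ⟨(b, s', t'), ?_, rfl⟩
    cases b <;> simpa [Literal.Holds] using h

theorem exists_code_eq {k : ℕ} (h : k % 4 < 2) : ∃ l : Literal ℕ, l.toQF.code = k := by
  refine ⟨(k % 4 == 1, termOfCode (k / 4).unpair.1, termOfCode (k / 4).unpair.2), ?_⟩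
  rw [Literal.code_toQF]
  simp only [termCode_termOfCode, Nat.pair_unpair]
  obtain h0 | h0 : k % 4 = 0 ∨ k % 4 = 1 := by omega
  all_goals simp only [h0]
  · simp; omega
  · simp; omega

theorem code_mod_four (l : Literal ℕ) : l.toQF.code % 4 < 2 := by
  rw [Literal.code_toQF]
  cases l.1 <;> simp

/-- The Gödel number of the equation between two terms. -/
def eqCode (s t : groupLang.Term ℕ) : ℕ := (Literal.toQF (true, s, t)).code

/-- The Gödel number of the negation of the equation between two terms. -/
def neCode (s t : groupLang.Term ℕ) : ℕ := (Literal.toQF (false, s, t)).code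

@[fun_prop] theorem computable_eqCode {σ : Type*} [Primcodable σ] {f g : σ → groupLang.Term ℕ}
    (hf : Computable f) (hg : Computable g) : Computable fun a => eqCode (f a) (g a) := by
  unfold eqCode; fun_prop

@[fun_prop] theorem computable_neCode {σ : Type*} [Primcodable σ] {f g : σ → groupLang.Term ℕ}
    (hf : Computable f) (hg : Computable g) : Computable fun a => neCode (f a) (g a) := by
  unfold neCode; fun_prop

theorem eqCode_mem_diagram {s t : groupLang.Term ℕ} :
    eqCode s t ∈ diagram U ↔ ∃ a, evalIn U s = some a ∧ evalIn U t = some a := by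
  simp [eqCode, toQF_code_mem_diagram]

theorem eqCode_var_mem_diagram {s : groupLang.Term ℕ} {i : ℕ} :
    eqCode s (.var i) ∈ diagram U ↔ ∃ h : i ∈ U, evalIn U s = some ⟨i, h⟩ := by
  rw [eqCode_mem_diagram]
  constructor
  · rintro ⟨a, ha, h⟩
    rw [evalIn_var] at h
    subst h
    exact ⟨a.2, ha⟩
  · rintro ⟨h, hs⟩
    exact ⟨_, hs, evalIn_var.2 rfl⟩

theorem mem_iff_eqCode_mem_diagram {i : ℕ} : eqCode (.var i) (.var i) ∈ diagram U ↔ i ∈ U := by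
  simp [eqCode_var_mem_diagram, evalIn_var]

/-- A first-order description of the sets that are atomic diagrams. -/
structure IsDiagram (D : Set ℕ) : Prop where
  literal (k : ℕ) : k ∈ D → k % 4 < 2
  var (p : ℕ × ℕ) : eqCode (.var p.1) (.var p.2) ∈ D → p.1 = p.2
  one : ∃ i, eqCode tOne (.var i) ∈ D
  unique (p : groupLang.Term ℕ × ℕ × ℕ) :
    eqCode p.1 (.var p.2.1) ∈ D ∧ eqCode p.1 (.var p.2.2) ∈ D → p.2.1 = p.2.2
  mem (p : groupLang.Term ℕ × ℕ) : eqCode p.1 (.var p.2) ∈ D → eqCode (.var p.2) (.var p.2) ∈ D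
  inv_total (i : ℕ) : eqCode (.var i) (.var i) ∈ D → ∃ j, eqCode (tInv (.var i)) (.var j) ∈ D
  mul_total (p : ℕ × ℕ) : eqCode (.var p.1) (.var p.1) ∈ D ∧ eqCode (.var p.2) (.var p.2) ∈ D →
    ∃ k, eqCode (tMul (.var p.1) (.var p.2)) (.var k) ∈ D
  inv (p : groupLang.Term ℕ × ℕ) : eqCode (tInv p.1) (.var p.2) ∈ D ↔
    ∃ m, eqCode p.1 (.var m) ∈ D ∧ eqCode (tInv (.var m)) (.var p.2) ∈ D
  mul (p : groupLang.Term ℕ × groupLang.Term ℕ × ℕ) : eqCode (tMul p.1 p.2.1) (.var p.2.2) ∈ D ↔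
    ∃ m n, (eqCode p.1 (.var m) ∈ D ∧ eqCode p.2.1 (.var n) ∈ D) ∧
      eqCode (tMul (.var m) (.var n)) (.var p.2.2) ∈ D
  eq (p : groupLang.Term ℕ × groupLang.Term ℕ) : eqCode p.1 p.2 ∈ D ↔
    ∃ i, eqCode p.1 (.var i) ∈ D ∧ eqCode p.2 (.var i) ∈ D
  ne (p : groupLang.Term ℕ × groupLang.Term ℕ) : neCode p.1 p.2 ∈ D ↔
    ∃ i j, (eqCode p.1 (.var i) ∈ D ∧ eqCode p.2 (.var j) ∈ D) ∧ (!(i == j)) = true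

theorem isDiagram_diagram (U : Set ℕ) [groupLang.Structure U] : IsDiagram (diagram U) where
  literal k h := by
    obtain ⟨l, -, rfl⟩ := Literal.mem_diagram_iff.1 h
    exact code_mod_four _
  var p h := by
    obtain ⟨h, hp⟩ := eqCode_var_mem_diagram.1 h
    exact evalIn_var.1 hp
  one := ⟨sOne U, eqCode_var_mem_diagram.2 ⟨(sOne U).2, evalIn_tOne⟩⟩
  unique p h := by
    obtain ⟨⟨_, h1⟩, _, h2⟩ := h.imp eqCode_var_mem_diagram.1 eqCode_var_mem_diagram.1
    rw [h1, Option.some_inj] at h2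
    exact congrArg Subtype.val h2
  mem p h := mem_iff_eqCode_mem_diagram.2 (eqCode_var_mem_diagram.1 h).1
  inv_total i h := by
    have h := mem_iff_eqCode_mem_diagram.1 h
    refine ⟨(sInv (⟨i, h⟩ : U) : U), eqCode_var_mem_diagram.2 ⟨Subtype.prop _, ?_⟩⟩
    rw [evalIn_tInv, evalIn_var.2 (show i = (⟨i, h⟩ : U) from rfl)]; rfl
  mul_total p h := by
    obtain ⟨h1, h2⟩ := h.imp mem_iff_eqCode_mem_diagram.1 mem_iff_eqCode_mem_diagram.1
    refine ⟨(sMul (⟨p.1, h1⟩ : U) ⟨p.2, h2⟩ : U), eqCode_var_mem_diagram.2 ⟨Subtype.prop _, ?_⟩⟩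
    rw [evalIn_tMul, evalIn_var.2 (show p.1 = (⟨p.1, h1⟩ : U) from rfl),
      evalIn_var.2 (show p.2 = (⟨p.2, h2⟩ : U) from rfl)]; rfl
  inv p := by
    simp only [eqCode_var_mem_diagram, evalIn_tInv, Option.map_eq_some_iff]
    constructor
    · rintro ⟨h, a, ha, h'⟩
      exact ⟨a, ⟨a.2, ha⟩, h, a, evalIn_var.2 rfl, h'⟩
    · rintro ⟨m, ⟨hm, h1⟩, h, a, ha, h'⟩
      refine ⟨h, a, ?_, h'⟩
      rw [h1, Option.some_inj]
      exact Subtype.ext (evalIn_var.1 ha)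
  mul p := by
    simp only [eqCode_var_mem_diagram, evalIn_tMul, Option.map₂_eq_some_iff]
    constructor
    · rintro ⟨h, a, b, ha, hb, h'⟩
      exact ⟨a, b, ⟨⟨a.2, ha⟩, b.2, hb⟩, h, a, b, evalIn_var.2 rfl, evalIn_var.2 rfl, h'⟩
    · rintro ⟨m, n, ⟨⟨hm, h1⟩, hn, h2⟩, h, a, b, ha, hb, h'⟩
      refine ⟨h, a, b, ?_, ?_, h'⟩
      · exact h1.trans (congrArg some (Subtype.ext (evalIn_var.1 ha)))
      · exact h2.trans (congrArg some (Subtype.ext (evalIn_var.1 hb)))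
  eq p := by
    rw [eqCode_mem_diagram]
    simp only [eqCode_var_mem_diagram]
    constructor
    · rintro ⟨a, h1, h2⟩
      exact ⟨a, ⟨a.2, h1⟩, a.2, h2⟩
    · rintro ⟨i, ⟨h, h1⟩, _, h2⟩
      exact ⟨_, h1, h2⟩
  ne p := by
    rw [neCode, toQF_code_mem_diagram]
    simp only [eqCode_var_mem_diagram]
    constructor
    · rintro ⟨a, b, h1, h2, h⟩
      refine ⟨a, b, ⟨⟨a.2, h1⟩, b.2, h2⟩, ?_⟩
      simpa [Subtype.ext_iff] using h
    · rintro ⟨i, j, ⟨⟨hi, h1⟩, hj, h2⟩, h⟩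
      exact ⟨_, _, h1, h2, by simpa using h⟩

/-- The universe consists of the `i` for which `i = i` is in `D`, and the operations are read off
the equations with a constant on the right. The clauses for compound terms then force, by induction,
every equation `t = i` in `D` to record the value of `t`. The clauses `eq`, `ne` and `literal`
settle all other members. -/
theorem IsDiagram.exists_structure {D : Set ℕ} (hD : IsDiagram D) :
    ∃ (U : Set ℕ) (_ : groupLang.Structure U), D = diagram U := by
  let U : Set ℕ := {i | eqCode (.var i) (.var i) ∈ D}
  obtain ⟨o, ho⟩ := hD.one
  have hi : ∀ a : U, ∃ b : U, eqCode (tInv (.var a)) (.var b) ∈ D := fun a => by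
    obtain ⟨b, hb⟩ := hD.inv_total a a.2
    exact ⟨⟨b, hD.mem (_, _) hb⟩, hb⟩
  have hm : ∀ a b : U, ∃ c : U, eqCode (tMul (.var a) (.var b)) (.var c) ∈ D := fun a b => by
    obtain ⟨c, hc⟩ := hD.mul_total (a, b) ⟨a.2, b.2⟩
    exact ⟨⟨c, hD.mem (_, _) hc⟩, hc⟩
  choose inv hinv using hi
  choose mul hmul using hm
  let S : groupLang.Structure U := structureOf ⟨o, hD.mem (_, _) ho⟩ inv mul
  refine ⟨U, S, ?_⟩
  have key : ∀ (t : groupLang.Term ℕ) (a : U), eqCode t (.var a) ∈ D ↔ evalIn U t = some a := by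
    intro t
    induction t using term_induction with
    | hvar i =>
      intro a
      rw [evalIn_var]
      exact ⟨hD.var (_, _), fun h => h ▸ a.2⟩
    | hone =>
      intro a
      rw [evalIn_tOne, Option.some_inj]
      refine ⟨fun h => Subtype.ext (hD.unique (_, _, _) ⟨ho, h⟩), ?_⟩
      rintro rfl
      exact ho
    | hinv t ih =>
      intro a
      rw [hD.inv (t, a), evalIn_tInv, Option.map_eq_some_iff]
      constructor
      · rintro ⟨m, h1, h2⟩
        refine ⟨⟨m, hD.mem (_, _) h1⟩, (ih _).1 h1, Subtype.ext ?_⟩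
        exact hD.unique (_, _, _) ⟨hinv ⟨m, hD.mem (_, _) h1⟩, h2⟩
      · rintro ⟨b, hb, rfl⟩
        exact ⟨b, (ih b).2 hb, hinv b⟩
    | hmul s t hs ht =>
      intro a
      rw [hD.mul (s, t, a), evalIn_tMul, Option.map₂_eq_some_iff]
      constructor
      · rintro ⟨m, n, ⟨h1, h2⟩, h3⟩
        refine ⟨⟨m, hD.mem (_, _) h1⟩, ⟨n, hD.mem (_, _) h2⟩, (hs _).1 h1, (ht _).1 h2,
          Subtype.ext ?_⟩
        exact hD.unique (_, _, _) ⟨hmul ⟨m, hD.mem (_, _) h1⟩ ⟨n, hD.mem (_, _) h2⟩, h3⟩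
      · rintro ⟨b, c, hb, hc, rfl⟩
        exact ⟨b, c, ⟨(hs b).2 hb, (ht c).2 hc⟩, hmul b c⟩
  have hlit : ∀ l : Literal ℕ, l.toQF.code ∈ D ↔ l.toQF.code ∈ diagram U := by
    rintro ⟨b, s, t⟩
    rw [toQF_code_mem_diagram]
    cases b
    · refine (hD.ne (s, t)).trans ⟨?_, ?_⟩
      · rintro ⟨i, j, ⟨h1, h2⟩, h⟩
        refine ⟨⟨i, hD.mem (_, _) h1⟩, ⟨j, hD.mem (_, _) h2⟩, (key _ _).1 h1, (key _ _).1 h2, ?_⟩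
        simpa using h
      · rintro ⟨a, b, h1, h2, h⟩
        refine ⟨a, b, ⟨(key _ _).2 h1, (key _ _).2 h2⟩, ?_⟩
        simpa [Subtype.ext_iff] using h
    · refine (hD.eq (s, t)).trans ⟨?_, ?_⟩
      · rintro ⟨i, h1, h2⟩
        exact ⟨⟨i, hD.mem (_, _) h1⟩, ⟨i, hD.mem (_, _) h1⟩, (key _ _).1 h1, (key _ _).1 h2, by simp⟩
      · rintro ⟨a, b, h1, h2, h⟩
        obtain rfl : a = b := by simpa using h
        exact ⟨a, (key _ _).2 h1, (key _ _).2 h2⟩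
  ext k
  constructor
  · intro h
    obtain ⟨l, rfl⟩ := exists_code_eq (hD.literal k h)
    exact (hlit l).1 h
  · intro h
    obtain ⟨l, rfl⟩ := exists_code_eq ((isDiagram_diagram U).literal k h)
    exact (hlit l).2 h

end Diagrams

/-! ### The index set is `Σ⁰₃` -/

/-- The predicate `P` is `Π⁰₂`. -/
def IsPi02 {α : Type*} [Primcodable α] (P : α → Prop) : Prop :=
  ∃ Q : α × ℕ → Prop, IsSigma01 Q ∧ ∀ a, P a ↔ ∀ y, Q (a, y)

namespace IsPi02

variable {α : Type*} [Primcodable α] {P Q : α → Prop}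

theorem of_sigma (hP : IsSigma01 P) : IsPi02 P :=
  ⟨fun p => P p.1, hP.comp (by fun_prop), fun a => by simp⟩

theorem of_iff (hP : IsPi02 P) (h : ∀ a, Q a ↔ P a) : IsPi02 Q := by
  obtain ⟨f, hf, hfP⟩ := hP
  exact ⟨f, hf, fun a => (h a).trans (hfP a)⟩

/-- The existential witness of the hypothesis becomes a universal quantifier in front; what follows
is a decidable condition or a `Σ⁰₁` one. -/
theorem imp (hP : IsSigma01 P) (hQ : IsSigma01 Q) : IsPi02 fun a => P a → Q a := by
  obtain ⟨f, hf, hfP⟩ := hP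
  refine ⟨fun p => (!f p) = true ∨ Q p.1,
    (IsSigma01.of_bool (by fun_prop)).or (hQ.comp (by fun_prop)), fun a => ?_⟩
  simp only [hfP, Bool.not_eq_true', ← Bool.not_eq_true, ← imp_iff_not_or]
  exact ⟨fun h y hy => h ⟨y, hy⟩, fun h ⟨y, hy⟩ => h y hy⟩

theorem and (hP : IsPi02 P) (hQ : IsPi02 Q) : IsPi02 fun a => P a ∧ Q a := by
  obtain ⟨P', hP', hP⟩ := hP
  obtain ⟨Q', hQ', hQ⟩ := hQ
  exact ⟨fun p => P' p ∧ Q' p, hP'.and hQ', fun a => by simp only [hP, hQ, forall_and]⟩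

theorem iff (hP : IsSigma01 P) (hQ : IsSigma01 Q) : IsPi02 fun a => P a ↔ Q a :=
  ((imp hP hQ).and (imp hQ hP)).of_iff fun _ => iff_iff_implies_and_implies

theorem all {δ : Type*} [Denumerable δ] {P : α → δ → Prop}
    (hP : IsPi02 fun p : α × δ => P p.1 p.2) : IsPi02 fun a => ∀ d, P a d := by
  obtain ⟨Q, hQ, hPQ⟩ := hP
  refine ⟨fun p => Q ((p.1, (Denumerable.ofNat (δ × ℕ) p.2).1), (Denumerable.ofNat (δ × ℕ) p.2).2),
    hQ.comp (by fun_prop), fun a => ?_⟩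
  simp only [fun d => hPQ (a, d)]
  constructor
  · exact fun h y => h _ _
  · intro h d y
    simpa only [Denumerable.ofNat_encode] using h (Encodable.encode (d, y))

theorem isSigma03 {P : ℕ × ℕ → Prop} (hP : IsPi02 P) {S : Set ℕ} (h : ∀ n, n ∈ S ↔ ∃ x, P (n, x)) :
    IsSigma03 S := by
  obtain ⟨Q, ⟨f, hf, hfQ⟩, hPQ⟩ := hP
  refine ⟨fun q => f (((q.1, q.2.1), q.2.2.1), q.2.2.2) = true, computablePred_iff.2
    ⟨_, by fun_prop, fun _ => Iff.rfl⟩, fun n => ?_⟩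
  simp only [h, hPQ, hfQ]

end IsPi02

/-- The set of the `k` for which `φ_e` has the value `1`. -/
def phiSet (e : ℕ) : Set ℕ := {k | 1 ∈ phi e k}

section

variable {α : Type*} [Primcodable α]

theorem isSigma01_eqCode_mem {e : α → ℕ} {s t : α → groupLang.Term ℕ} (he : Computable e)
    (hs : Computable s) (ht : Computable t) :
    IsSigma01 fun a => eqCode (s a) (t a) ∈ phiSet (e a) :=
  (isSigma01_mem_phi 1).comp (g := fun a => (e a, eqCode (s a) (t a))) (by fun_prop)

theorem isSigma01_neCode_mem {e : α → ℕ} {s t : α → groupLang.Term ℕ} (he : Computable e)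
    (hs : Computable s) (ht : Computable t) :
    IsSigma01 fun a => neCode (s a) (t a) ∈ phiSet (e a) :=
  (isSigma01_mem_phi 1).comp (g := fun a => (e a, neCode (s a) (t a))) (by fun_prop)

end

/-- Membership in `phiSet e` is `Σ⁰₁`, and each clause is a `Σ⁰₁` statement or a universally
quantified implication or equivalence between `Σ⁰₁` statements. -/
theorem isPi02_isDiagram : IsPi02 fun e : ℕ => IsDiagram (phiSet e) := by
  have h1 : IsPi02 fun e => ∀ k, k ∈ phiSet e → k % 4 < 2 :=
    .all (.imp ((isSigma01_mem_phi 1).comp (by fun_prop))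
      (.of_computable (f := fun p => Nat.ble (p.2 % 4 + 1) 2) (by fun_prop)
        fun p => by rw [Nat.ble_eq]; rfl))
  have h2 : IsPi02 fun e => ∀ p : ℕ × ℕ, eqCode (.var p.1) (.var p.2) ∈ phiSet e → p.1 = p.2 :=
    .all (.imp (isSigma01_eqCode_mem (by fun_prop) (by fun_prop) (by fun_prop))
      (.of_computable (f := fun p => p.2.1 == p.2.2) (by fun_prop) fun p => by simp))
  have h3 : IsPi02 fun e => ∃ i, eqCode tOne (.var i) ∈ phiSet e :=
    .of_sigma (.ex (isSigma01_eqCode_mem (by fun_prop) (by fun_prop) (by fun_prop)))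
  have h4 : IsPi02 fun e => ∀ p : groupLang.Term ℕ × ℕ × ℕ, eqCode p.1 (.var p.2.1) ∈ phiSet e ∧
      eqCode p.1 (.var p.2.2) ∈ phiSet e → p.2.1 = p.2.2 :=
    .all (.imp ((isSigma01_eqCode_mem (by fun_prop) (by fun_prop) (by fun_prop)).and
      (isSigma01_eqCode_mem (by fun_prop) (by fun_prop) (by fun_prop)))
      (.of_computable (f := fun p => p.2.2.1 == p.2.2.2) (by fun_prop) fun p => by simp))
  have h5 : IsPi02 fun e => ∀ p : groupLang.Term ℕ × ℕ, eqCode p.1 (.var p.2) ∈ phiSet e →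
      eqCode (.var p.2) (.var p.2) ∈ phiSet e :=
    .all (.imp (isSigma01_eqCode_mem (by fun_prop) (by fun_prop) (by fun_prop))
      (isSigma01_eqCode_mem (by fun_prop) (by fun_prop) (by fun_prop)))
  have h6 : IsPi02 fun e => ∀ i : ℕ, eqCode (.var i) (.var i) ∈ phiSet e →
      ∃ j, eqCode (tInv (.var i)) (.var j) ∈ phiSet e :=
    .all (.imp (isSigma01_eqCode_mem (by fun_prop) (by fun_prop) (by fun_prop))
      (.ex (isSigma01_eqCode_mem (by fun_prop) (by fun_prop) (by fun_prop))))
  have h7 : IsPi02 fun e => ∀ p : ℕ × ℕ, eqCode (.var p.1) (.var p.1) ∈ phiSet e ∧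
      eqCode (.var p.2) (.var p.2) ∈ phiSet e →
      ∃ k, eqCode (tMul (.var p.1) (.var p.2)) (.var k) ∈ phiSet e :=
    .all (.imp ((isSigma01_eqCode_mem (by fun_prop) (by fun_prop) (by fun_prop)).and
      (isSigma01_eqCode_mem (by fun_prop) (by fun_prop) (by fun_prop)))
      (.ex (isSigma01_eqCode_mem (by fun_prop) (by fun_prop) (by fun_prop))))
  have h8 : IsPi02 fun e => ∀ p : groupLang.Term ℕ × ℕ,
      eqCode (tInv p.1) (.var p.2) ∈ phiSet e ↔
        ∃ m, eqCode p.1 (.var m) ∈ phiSet e ∧ eqCode (tInv (.var m)) (.var p.2) ∈ phiSet e :=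
    .all (.iff (isSigma01_eqCode_mem (by fun_prop) (by fun_prop) (by fun_prop))
      (.ex ((isSigma01_eqCode_mem (by fun_prop) (by fun_prop) (by fun_prop)).and
        (isSigma01_eqCode_mem (by fun_prop) (by fun_prop) (by fun_prop)))))
  have h9 : IsPi02 fun e => ∀ p : groupLang.Term ℕ × groupLang.Term ℕ × ℕ,
      eqCode (tMul p.1 p.2.1) (.var p.2.2) ∈ phiSet e ↔
        ∃ m n, (eqCode p.1 (.var m) ∈ phiSet e ∧ eqCode p.2.1 (.var n) ∈ phiSet e) ∧
          eqCode (tMul (.var m) (.var n)) (.var p.2.2) ∈ phiSet e :=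
    .all (.iff (isSigma01_eqCode_mem (by fun_prop) (by fun_prop) (by fun_prop))
      (.ex (.ex (((isSigma01_eqCode_mem (by fun_prop) (by fun_prop) (by fun_prop)).and
        (isSigma01_eqCode_mem (by fun_prop) (by fun_prop) (by fun_prop))).and
        (isSigma01_eqCode_mem (by fun_prop) (by fun_prop) (by fun_prop))))))
  have h10 : IsPi02 fun e => ∀ p : groupLang.Term ℕ × groupLang.Term ℕ,
      eqCode p.1 p.2 ∈ phiSet e ↔
        ∃ i, eqCode p.1 (.var i) ∈ phiSet e ∧ eqCode p.2 (.var i) ∈ phiSet e :=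
    .all (.iff (isSigma01_eqCode_mem (by fun_prop) (by fun_prop) (by fun_prop))
      (.ex ((isSigma01_eqCode_mem (by fun_prop) (by fun_prop) (by fun_prop)).and
        (isSigma01_eqCode_mem (by fun_prop) (by fun_prop) (by fun_prop)))))
  have h11 : IsPi02 fun e => ∀ p : groupLang.Term ℕ × groupLang.Term ℕ,
      neCode p.1 p.2 ∈ phiSet e ↔ ∃ i j, (eqCode p.1 (.var i) ∈ phiSet e ∧
        eqCode p.2 (.var j) ∈ phiSet e) ∧ (!(i == j)) = true :=
    .all (.iff (isSigma01_neCode_mem (by fun_prop) (by fun_prop) (by fun_prop))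
      (.ex (.ex (((isSigma01_eqCode_mem (by fun_prop) (by fun_prop) (by fun_prop)).and
        (isSigma01_eqCode_mem (by fun_prop) (by fun_prop) (by fun_prop))).and
        (.of_bool (by fun_prop))))))
  refine (h1.and (h2.and (h3.and (h4.and (h5.and (h6.and (h7.and (h8.and (h9.and
    (h10.and h11)))))))))).of_iff fun e => ⟨?_, ?_⟩
  · rintro ⟨g1, g2, g3, g4, g5, g6, g7, g8, g9, g10, g11⟩
    exact ⟨g1, g2, g3, g4, g5, g6, g7, g8, g9, g10, g11⟩
  · rintro ⟨g1, g2, g3, g4, g5, g6, g7, g8, g9, g10, g11⟩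
    exact ⟨g1, g2, g3, g4, g5, g6, g7, g8, g9, g10, g11⟩

/-- The axioms `IsModel`, expressed in terms of the atomic diagram. -/
def ModelIn (E : ℕ → ℕ × ℕ × ℕ) (D : Set ℕ) (x : ℕ) : Prop :=
  eqCode (.var x) (.var x) ∈ D ∧ ∀ p : ℕ × ℕ × ℕ × ℕ,
    eqCode (.var p.2.1) (.var p.2.1) ∈ D ∧ eqCode (.var p.2.2.1) (.var p.2.2.1) ∈ D ∧
      eqCode (.var p.2.2.2) (.var p.2.2.2) ∈ D →
    ∃ j d, eqCode (.var d) (.var d) ∈ D ∧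
      (clause E p.1 j x p.2.1 p.2.2.1 p.2.2.2 d).toQF.code ∈ D

theorem modelIn_diagram {E : ℕ → ℕ × ℕ × ℕ} {U : Set ℕ} [groupLang.Structure U] {x : ℕ} :
    ModelIn E (diagram U) x ↔ ∃ h : x ∈ U, IsModel E (⟨x, h⟩ : U) := by
  simp only [ModelIn, mem_iff_eqCode_mem_diagram]
  have key : ∀ i j (x a b c d : U), (clause E i j (x : ℕ) a b c d).toQF.code ∈ diagram U ↔
      (clause E i j x a b c d).Holds id := fun i j x a b c d => by
    rw [← Literal.code_mem_diagram_iff, relabel_clause]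
  constructor
  · rintro ⟨hx, h⟩
    refine ⟨hx, fun i a b c => ?_⟩
    obtain ⟨j, d, hd, hj⟩ := h (i, a, b, c) ⟨a.2, b.2, c.2⟩
    exact ⟨j, ⟨d, hd⟩, (key i j ⟨x, hx⟩ a b c ⟨d, hd⟩).1 hj⟩
  · rintro ⟨hx, h⟩
    refine ⟨hx, fun p hp => ?_⟩
    obtain ⟨j, d, hd⟩ := h p.1 ⟨_, hp.1⟩ ⟨_, hp.2.1⟩ ⟨_, hp.2.2⟩
    exact ⟨j, d, d.2, (key _ _ _ _ _ _ _).2 hd⟩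

theorem isPi02_modelIn {E : ℕ → ℕ × ℕ × ℕ} (hE : Computable E) :
    IsPi02 fun p : ℕ × ℕ => ModelIn E (phiSet p.1) p.2 := by
  refine IsPi02.and (.of_sigma (isSigma01_eqCode_mem (by fun_prop) (by fun_prop) (by fun_prop)))
    (.all (.imp ((isSigma01_eqCode_mem (by fun_prop) (by fun_prop) (by fun_prop)).and
      ((isSigma01_eqCode_mem (by fun_prop) (by fun_prop) (by fun_prop)).and
      (isSigma01_eqCode_mem (by fun_prop) (by fun_prop) (by fun_prop))))
      (.ex (.ex ((isSigma01_eqCode_mem (by fun_prop) (by fun_prop) (by fun_prop)).and ?_)))))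
  have : Computable fun q : (((ℕ × ℕ) × ℕ × ℕ × ℕ × ℕ) × ℕ) × ℕ =>
      clause E q.1.1.2.1 q.1.2 q.1.1.1.2 q.1.1.2.2.1 q.1.1.2.2.2.1 q.1.1.2.2.2.2 q.2 :=
    computable_clause hE (by fun_prop) (by fun_prop) (by fun_prop) (by fun_prop) (by fun_prop)
      (by fun_prop) (by fun_prop)
  exact (isSigma01_mem_phi 1).comp (g := fun q : (((ℕ × ℕ) × ℕ × ℕ × ℕ × ℕ) × ℕ) × ℕ =>
    (q.1.1.1.1, (clause E q.1.1.2.1 q.1.2 q.1.1.1.2 q.1.1.2.2.1 q.1.1.2.2.2.1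
      q.1.1.2.2.2.2 q.2).toQF.code)) (by fun_prop)

/-- The only unbounded quantifier outside the `Π⁰₂` part is the choice of `x`. The `Π⁰₂` part says
that `φ_e` is total with values `0` or `1`, that its value `1` marks an atomic diagram, and that the
axioms hold there for `x`. -/
theorem isSigma03_indexSet {A : Type} [groupLang.Structure A] {E : ℕ → ℕ × ℕ × ℕ}
    (hE : Computable E)
    (h : ∀ (M : Type) [groupLang.Structure M],
      Nonempty (M ≃[groupLang] A) ↔ ∃ x : M, IsModel E x) :
    IsSigma03 (indexSet A) := by
  have htot : IsPi02 fun e : ℕ => ∀ k : ℕ, 0 ∈ phi e k ∨ 1 ∈ phi e k :=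
    .all (.of_sigma ((isSigma01_mem_phi 0).or (isSigma01_mem_phi 1)))
  have comp : ∀ {P : ℕ → Prop}, IsPi02 P → IsPi02 fun p : ℕ × ℕ => P p.1 := by
    rintro P ⟨Q, hQ, hPQ⟩
    exact ⟨fun q => Q (q.1.1, q.2), hQ.comp (by fun_prop), fun a => hPQ a.1⟩
  refine ((comp htot).and ((comp isPi02_isDiagram).and (isPi02_modelIn hE))).isSigma03 fun e => ?_
  constructor
  · rintro ⟨U, S, hU, he⟩
    have hD : phiSet e = diagram U := by
      ext k
      change 1 ∈ phi e k ↔ _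
      rw [he k, Part.mem_some_iff]
      split_ifs with hk <;> simp [hk]
    obtain ⟨x, hx⟩ := (h U).1 hU
    refine ⟨x, fun k => ?_, ?_, ?_⟩
    · change 0 ∈ phi e k ∨ 1 ∈ phi e k
      rw [he k, Part.mem_some_iff, Part.mem_some_iff]
      split_ifs <;> simp
    · simp only [hD]
      exact isDiagram_diagram U
    · simp only [hD]
      exact modelIn_diagram.2 ⟨x.2, hx⟩
  · rintro ⟨x, ht, hd, hm⟩
    obtain ⟨U, S, hD⟩ := hd.exists_structure
    simp only [hD] at hm
    refine ⟨U, S, (h U).2 ?_, fun k => ?_⟩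
    · obtain ⟨hx, hm⟩ := modelIn_diagram.1 hm
      exact ⟨_, hm⟩
    · rw [← hD]
      split_ifs with hk
      · exact Part.eq_some_iff.2 hk
      · exact Part.eq_some_iff.2 ((ht k).resolve_right hk)

/-! ### Reduction of `Σ⁰₃` sets to cofiniteness -/

/-- A `Σ⁰₃` condition says that some set in a computable sequence of sets is infinite. -/
theorem exists_infinite_of_isSigma03 {S : Set ℕ} (hS : IsSigma03 S) :
    ∃ h : ℕ × ℕ × ℕ → Bool, Computable h ∧
      ∀ n, n ∈ S ↔ ∃ x, {t | h (n, x, t) = true}.Infinite := by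
  obtain ⟨R, hR, hRS⟩ := hS
  obtain ⟨r, hr, hrR⟩ := computablePred_iff.1 hR
  -- `w` says that `z` is the least witness for `y`. Uniqueness of least witnesses is what makes the
  -- count of coded lists below meaningful.
  let w : ℕ × ℕ × ℕ × ℕ → Bool := fun q =>
    r q && ballBool (fun z => !r (q.1, q.2.1, q.2.2.1, z)) q.2.2.2
  have hw : Computable w := by
    have : Computable fun q : ℕ × ℕ × ℕ × ℕ =>
        ballBool (fun z => !r (q.1, q.2.1, q.2.2.1, z)) q.2.2.2 :=
      computable_ballBool (by fun_prop) (by fun_prop)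
    fun_prop
  -- `t` is accepted when it codes the list of least witnesses for all `y` below its length. There
  -- is one such list for each length up to the first `y` without a witness, so infinitely many
  -- exactly when every `y` has one.
  let h : ℕ × ℕ × ℕ → Bool := fun q => ballBool
    (fun i => w (q.1, q.2.1, i, ((Denumerable.ofNat (List ℕ) q.2.2)[i]?).getD 0))
    (Denumerable.ofNat (List ℕ) q.2.2).length
  refine ⟨h, computable_ballBool (by fun_prop) (by fun_prop), fun n => (hRS n).trans ?_⟩
  refine exists_congr fun x => ?_
  have hZ : ∃ Z : ℕ → ℕ, ∀ y z, w (n, x, y, z) = true ↔ (∃ z', r (n, x, y, z') = true) ∧ z = Z y := by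
    classical
    refine ⟨fun y => if hy : ∃ z', r (n, x, y, z') = true then Nat.find hy else 0, fun y z => ?_⟩
    simp only [w, Bool.and_eq_true, ballBool_eq_true, Bool.not_eq_true']
    by_cases hy : ∃ z', r (n, x, y, z') = true
    · rw [dif_pos hy, eq_comm (a := z), Nat.find_eq_iff]
      simp [hy]
    · simp only [hy, false_and, iff_false, not_and]
      exact fun h => absurd ⟨z, h⟩ hy
  obtain ⟨Z, hZ⟩ := hZ
  let enc : ℕ → ℕ := fun m => Encodable.encode ((List.range m).map Z)
  have hinj : Function.Injective enc := by
    intro m m' e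
    simpa using congrArg List.length (Encodable.encode_injective e)
  have key : {t | h (n, x, t) = true} = enc '' {m | ∀ y < m, ∃ z, r (n, x, y, z) = true} := by
    ext t
    obtain ⟨l, rfl⟩ : ∃ l : List ℕ, Encodable.encode l = t :=
      ⟨Denumerable.ofNat _ t, Denumerable.encode_ofNat t⟩
    change h (n, x, Encodable.encode l) = true ↔ _
    simp only [h, Denumerable.ofNat_encode, ballBool_eq_true, hZ]
    constructor
    · intro hl
      refine ⟨l.length, fun y hy => (hl y hy).1, ?_⟩
      refine congrArg Encodable.encode (?_ : (List.range l.length).map Z = l)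
      refine List.ext_getElem (by simp) fun i h1 h2 => ?_
      simpa [h2] using (hl i h2).2.symm
    · rintro ⟨m, hm, e⟩
      obtain rfl := Encodable.encode_injective e
      intro i hi
      have hi' : i < m := by simpa using hi
      exact ⟨hm i hi', by simp [hi']⟩
  rw [key, Set.infinite_image_iff hinj.injOn]
  simp only [hrR]
  constructor
  · intro hall
    have : {m : ℕ | ∀ y < m, ∃ z, r (n, x, y, z) = true} = Set.univ :=
      Set.eq_univ_of_forall fun m y _ => hall y
    rw [this]
    exact Set.infinite_univ
  · intro hinf y
    obtain ⟨m, hm, hym⟩ := hinf.exists_gt y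
    exact hm y hym

/-- Every `Σ⁰₃` set is reducible to the problem whether a c.e. set is cofinite. -/
theorem exists_cofinite_of_isSigma03 {S : Set ℕ} (hS : IsSigma03 S) :
    ∃ V : ℕ × ℕ → Prop, IsSigma01 V ∧ ∀ n, n ∈ S ↔ {j | ¬ V (n, j)}.Finite := by
  obtain ⟨h, hh, hS⟩ := exists_infinite_of_isSigma03 hS
  -- Taking unions over `x' ≤ x` makes the sets increase with `x`, so from some `x` on all are
  -- infinite if any is.
  let H : ℕ → ℕ → ℕ → Bool := fun n x t => !ballBool (fun x' => !h (n, x', t)) (x + 1)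
  have hH : Computable fun q : ℕ × ℕ × ℕ => H q.1 q.2.1 q.2.2 := by
    have : Computable fun q : ℕ × ℕ × ℕ =>
        ballBool (fun x' => !h (q.1, x', q.2.2)) (q.2.1 + 1) :=
      computable_ballBool (by fun_prop) (by fun_prop)
    fun_prop
  have hH_iff : ∀ n x t, H n x t = true ↔ ∃ x' ≤ x, h (n, x', t) = true := by
    intro n x t
    simp only [H, Bool.not_eq_true', ← Bool.not_eq_true, ballBool_eq_true]
    push Not
    simp
  have hS' : ∀ n, n ∈ S ↔ ∃ x, {t | H n x t = true}.Infinite := by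
    intro n
    rw [hS]
    constructor
    · rintro ⟨x, hx⟩
      exact ⟨x, hx.mono fun t ht => (hH_iff n x t).2 ⟨x, le_rfl, ht⟩⟩
    · rintro ⟨x, hx⟩
      by_contra hcon
      push Not at hcon
      refine hx (((Set.finite_Iic x).biUnion fun x' _ => hcon x').subset fun t ht => ?_)
      obtain ⟨x', hx', h'⟩ := (hH_iff n x t).1 ht
      exact Set.mem_biUnion hx' h'
  -- The pair of `x` and `t` stays outside `V` exactly when `t` is the greatest element of `{0} ∪ {t
  -- | H n x t}`. A column thus omits one point if its set is finite and none if it is infinite; the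
  -- added `0` covers empty sets.
  let V : ℕ × ℕ → Prop := fun q =>
    (!(q.2.unpair.2 == 0) && !H q.1 q.2.unpair.1 q.2.unpair.2) = true ∨
      ∃ s, (Nat.ble (q.2.unpair.2 + 1) s && H q.1 q.2.unpair.1 s) = true
  have hV : IsSigma01 V := by
    refine (IsSigma01.of_bool ?_).or (IsSigma01.ex (IsSigma01.of_bool ?_))
    · have : Computable fun q : ℕ × ℕ => H q.1 q.2.unpair.1 q.2.unpair.2 :=
        hH.comp (g := fun q : ℕ × ℕ => (q.1, q.2.unpair.1, q.2.unpair.2)) (by fun_prop)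
      fun_prop
    · have : Computable fun q : (ℕ × ℕ) × ℕ => H q.1.1 q.1.2.unpair.1 q.2 :=
        hH.comp (g := fun q : (ℕ × ℕ) × ℕ => (q.1.1, q.1.2.unpair.1, q.2)) (by fun_prop)
      fun_prop
  have hV_iff : ∀ n x t, ¬ V (n, Nat.pair x t) ↔
      (t = 0 ∨ H n x t = true) ∧ ∀ s, t < s → ¬ H n x s = true := by
    intro n x t
    simp only [V, Nat.unpair_pair, Bool.and_eq_true, Nat.ble_eq]
    simp [or_iff_not_imp_left]
  refine ⟨V, hV, fun n => (hS' n).trans ⟨?_, ?_⟩⟩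
  · rintro ⟨x₀, hx₀⟩
    have hsub : {j | ¬ V (n, j)} ⊆
        ⋃ x ∈ Set.Iio x₀, Nat.pair x '' {t | ¬ V (n, Nat.pair x t)} := by
      intro j hj
      obtain ⟨x, t, rfl⟩ : ∃ x t, Nat.pair x t = j := ⟨_, _, Nat.pair_unpair j⟩
      refine Set.mem_biUnion (x := x) ?_ ⟨t, hj, rfl⟩
      by_contra hx
      obtain ⟨s, hs, hts⟩ := hx₀.exists_gt t
      obtain ⟨x', hx', h'⟩ := (hH_iff n x₀ s).1 hs
      exact ((hV_iff n x t).1 hj).2 s hts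
        ((hH_iff n x s).2 ⟨x', hx'.trans (not_lt.1 hx), h'⟩)
    refine Set.Finite.subset ((Set.finite_Iio x₀).biUnion fun x _ => Set.Finite.image _ ?_) hsub
    refine Set.Subsingleton.finite fun t ht t' ht' => ?_
    have h1 := (hV_iff n x t).1 ht
    have h2 := (hV_iff n x t').1 ht'
    rcases lt_trichotomy t t' with hlt | rfl | hlt
    · exact absurd (h2.1.resolve_left (by omega)) (h1.2 _ hlt)
    · rfl
    · exact absurd (h1.1.resolve_left (by omega)) (h2.2 _ hlt)
  · intro hfin
    by_contra hcon
    push Not at hcon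
    have : ∀ x, ∃ t, ¬ V (n, Nat.pair x t) := by
      intro x
      have hf : ({0} ∪ {t | H n x t = true}).Finite := (Set.finite_singleton 0).union (hcon x)
      obtain ⟨t, ht, hmax⟩ := hf.exists_maximal ⟨0, .inl rfl⟩
      refine ⟨t, (hV_iff n x t).2 ⟨ht, fun s hts hs => ?_⟩⟩
      exact absurd (hmax (.inr hs) hts.le) (not_le.2 hts)
    choose t ht using this
    refine Set.infinite_of_injective_forall_mem (f := fun x => Nat.pair x (t x)) ?_ ht hfin
    intro x y e
    exact (Nat.pair_eq_pair.1 e).1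

/-! ### Uniformly computable copies -/

/-- The operations on rational numbers coded by triples, with a flag that tells whether the value
is defined. -/
instance flaggedStructure : groupLang.Structure (Bool × ℕ × ℕ × ℕ) :=
  structureOf (true, 0, 0, 0) (fun a => (a.1, a.2.2.1, a.2.1, a.2.2.2))
    (fun a b => (a.1 && b.1, a.2.1 * (b.2.2.2 + 1) + b.2.1 * (a.2.2.2 + 1),
      a.2.2.1 * (b.2.2.2 + 1) + b.2.2.1 * (a.2.2.2 + 1),
      (a.2.2.2 + 1) * (b.2.2.2 + 1) - 1))

theorem rat_neg (t : ℕ × ℕ × ℕ) : rat (t.2.1, t.1, t.2.2) = -rat t := by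
  simp only [rat]; ring

theorem rat_add (s t : ℕ × ℕ × ℕ) : rat (s.1 * (t.2.2 + 1) + t.1 * (s.2.2 + 1),
    s.2.1 * (t.2.2 + 1) + t.2.1 * (s.2.2 + 1), (s.2.2 + 1) * (t.2.2 + 1) - 1) = rat s + rat t := by
  have h : (((s.2.2 + 1) * (t.2.2 + 1) - 1 : ℕ) : ℚ) + 1 = (s.2.2 + 1) * (t.2.2 + 1) := by
    rw [← Nat.cast_add_one, Nat.sub_add_cancel (Nat.mul_pos (Nat.succ_pos _) (Nat.succ_pos _))]
    push_cast; rfl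
  have h1 : (s.2.2 : ℚ) + 1 ≠ 0 := by positivity
  have h2 : (t.2.2 : ℚ) + 1 ≠ 0 := by positivity
  simp only [rat, h]
  rw [div_add_div _ _ h1 h2]
  push_cast; ring

/-- Equality of rational numbers coded by triples. -/
def ratEq (s t : ℕ × ℕ × ℕ) : Bool :=
  s.1 * (t.2.2 + 1) + t.2.1 * (s.2.2 + 1) == t.1 * (s.2.2 + 1) + s.2.1 * (t.2.2 + 1)

theorem ratEq_iff {s t : ℕ × ℕ × ℕ} : ratEq s t = true ↔ rat s = rat t := by
  have h1 : (s.2.2 : ℚ) + 1 ≠ 0 := by positivity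
  have h2 : (t.2.2 : ℚ) + 1 ≠ 0 := by positivity
  rw [ratEq, beq_iff_eq, rat, rat, div_eq_div_iff h1 h2, ← @Nat.cast_inj ℚ]
  push_cast
  constructor <;> intro h <;> linarith

@[fun_prop] theorem computable_ratEq {σ : Type*} [Primcodable σ] {f g : σ → ℕ × ℕ × ℕ}
    (hf : Computable f) (hg : Computable g) : Computable fun a => ratEq (f a) (g a) := by
  unfold ratEq; fun_prop

section Copies

variable (E : ℕ × ℕ → ℕ × ℕ × ℕ)

/-- Whether the `i`-th element of the `n`-th enumeration did not occur before. -/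
def isNew (n i : ℕ) : Bool := ballBool (fun j => !ratEq (E (n, j)) (E (n, i))) i

/-- The value of a term, if its constants are indices of first occurrences in the `n`-th
enumeration. -/
def evalAt (n : ℕ) (t : groupLang.Term ℕ) : Bool × ℕ × ℕ × ℕ :=
  t.realize fun i => (isNew E n i, E (n, i))

variable {E}

theorem isNew_iff {n i : ℕ} : isNew E n i = true ↔ ∀ j < i, rat (E (n, j)) ≠ rat (E (n, i)) := by
  simp only [isNew, ballBool_eq_true, Bool.not_eq_true', ← Bool.not_eq_true, ratEq_iff, ne_eq]

theorem computable_isNew (hE : Computable E) {σ : Type*} [Primcodable σ] {n i : σ → ℕ}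
    (hn : Computable n) (hi : Computable i) : Computable fun a => isNew E (n a) (i a) := by
  unfold isNew
  exact computable_ballBool (by fun_prop) hi

theorem evalAt_tInv (n : ℕ) (t : groupLang.Term ℕ) : evalAt E n (tInv t) = sInv (evalAt E n t) := by
  rw [evalAt, realize_tInv]; rfl

theorem evalAt_tMul (n : ℕ) (s t : groupLang.Term ℕ) :
    evalAt E n (tMul s t) = sMul (evalAt E n s) (evalAt E n t) := by
  rw [evalAt, realize_tMul]; rfl

/-- Course-of-values recursion on Gödel numbers: subterms have smaller numbers, and the length of
the list of earlier values is the number being treated. -/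
theorem computable_evalAt (hE : Computable E) :
    Computable fun p : ℕ × ℕ => evalAt E p.1 (termOfCode p.2) := by
  have hnew : Computable fun p : ℕ × List (Bool × ℕ × ℕ × ℕ) =>
      isNew E p.1 ((p.2.length - 1) / 3) := computable_isNew hE (by fun_prop) (by fun_prop)
  let look : List (Bool × ℕ × ℕ × ℕ) → ℕ → Bool × ℕ × ℕ × ℕ := fun l i => (l[i]?).getD default
  have hlook : Computable fun p : List (Bool × ℕ × ℕ × ℕ) × ℕ => look p.1 p.2 := by fun_prop
  let neg : Bool × ℕ × ℕ × ℕ → Bool × ℕ × ℕ × ℕ := sInv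
  have hneg : Computable neg := by
    change Computable fun a : Bool × ℕ × ℕ × ℕ => (a.1, a.2.2.1, a.2.1, a.2.2.2)
    fun_prop
  let add : (Bool × ℕ × ℕ × ℕ) × Bool × ℕ × ℕ × ℕ → Bool × ℕ × ℕ × ℕ := fun p => sMul p.1 p.2
  have hadd : Computable add := by
    change Computable fun p : (Bool × ℕ × ℕ × ℕ) × Bool × ℕ × ℕ × ℕ =>
      (p.1.1 && p.2.1, p.1.2.1 * (p.2.2.2.2 + 1) + p.2.2.1 * (p.1.2.2.2 + 1),
      p.1.2.2.1 * (p.2.2.2.2 + 1) + p.2.2.2.1 * (p.1.2.2.2 + 1),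
      (p.1.2.2.2 + 1) * (p.2.2.2.2 + 1) - 1)
    fun_prop
  let g : ℕ → List (Bool × ℕ × ℕ × ℕ) → Option (Bool × ℕ × ℕ × ℕ) := fun n l => some
    (bif l.length == 0 then (true, 0, 0, 0)
    else bif (l.length - 1) % 3 == 0 then
      (isNew E n ((l.length - 1) / 3), E (n, (l.length - 1) / 3))
    else bif (l.length - 1) % 3 == 1 then neg (look l ((l.length - 1) / 3))
    else add (look l ((l.length - 1) / 3).unpair.1, look l ((l.length - 1) / 3).unpair.2))
  have hg : Computable₂ g := by
    have h1 : Computable fun p : ℕ × List (Bool × ℕ × ℕ × ℕ) => look p.2 ((p.2.length - 1) / 3) :=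
      hlook.comp (g := fun p : ℕ × List (Bool × ℕ × ℕ × ℕ) => (p.2, (p.2.length - 1) / 3))
        (by fun_prop)
    have h2 : Computable fun p : ℕ × List (Bool × ℕ × ℕ × ℕ) =>
        look p.2 ((p.2.length - 1) / 3).unpair.1 :=
      hlook.comp (g := fun p : ℕ × List (Bool × ℕ × ℕ × ℕ) => (p.2, ((p.2.length - 1) / 3).unpair.1))
        (by fun_prop)
    have h3 : Computable fun p : ℕ × List (Bool × ℕ × ℕ × ℕ) =>
        look p.2 ((p.2.length - 1) / 3).unpair.2 :=
      hlook.comp (g := fun p : ℕ × List (Bool × ℕ × ℕ × ℕ) => (p.2, ((p.2.length - 1) / 3).unpair.2))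
        (by fun_prop)
    refine Computable.to₂ (f := fun p : ℕ × List (Bool × ℕ × ℕ × ℕ) => g p.1 p.2) ?_
    fun_prop
  refine Computable.nat_strong_rec (fun n k => evalAt E n (termOfCode k)) hg fun n k => ?_
  have hl : ∀ i < k, look ((List.range k).map fun k => evalAt E n (termOfCode k)) i =
      evalAt E n (termOfCode i) := fun i hi => by simp [look, hi]
  simp only [g, List.length_map, List.length_range, Option.some_inj]
  rcases k with _ | m
  · rw [termOfCode, evalAt, realize_tOne]; rfl
  · have hl' := Nat.unpair_left_le (m / 3)
    have hr' := Nat.unpair_right_le (m / 3)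
    rw [termOfCode]
    simp only [Nat.add_sub_cancel, beq_false_of_ne (Nat.succ_ne_zero m), cond_false]
    by_cases h0 : m % 3 = 0
    · simp [h0, evalAt]
    · by_cases h1 : m % 3 = 1
      · simp [h1, evalAt_tInv, hl _ (show m / 3 < m + 1 by omega), neg]
      · simp [beq_false_of_ne h0, beq_false_of_ne h1, h0, h1, evalAt_tMul,
          hl _ (show (m / 3).unpair.1 < m + 1 by omega),
          hl _ (show (m / 3).unpair.2 < m + 1 by omega), add]

/-- Uniformly enumerable subgroups of the rationals have copies with uniformly computable
diagrams. -/
theorem exists_computable_copies (hE : Computable E) (H : ℕ → AddSubgroup ℚ)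
    (hH : ∀ n q, q ∈ H n ↔ ∃ i, rat (E (n, i)) = q) :
    ∃ f : ℕ → ℕ, Computable f ∧ ∀ n, ∃ (U : Set ℕ) (_ : groupLang.Structure U),
      Nonempty (U ≃[groupLang] H n) ∧
      ∀ k, (k ∈ diagram U → phi (f n) k = Part.some 1) ∧
        (k ∉ diagram U → phi (f n) k = Part.some 0) := by
  let s : ℕ × ℕ → Bool × ℕ × ℕ × ℕ := fun p => evalAt E p.1 (termOfCode (p.2 / 4).unpair.1)
  let t : ℕ × ℕ → Bool × ℕ × ℕ × ℕ := fun p => evalAt E p.1 (termOfCode (p.2 / 4).unpair.2)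
  have hs : Computable s := (computable_evalAt hE).comp
    (g := fun p : ℕ × ℕ => (p.1, (p.2 / 4).unpair.1)) (by fun_prop)
  have ht : Computable t := (computable_evalAt hE).comp
    (g := fun p : ℕ × ℕ => (p.1, (p.2 / 4).unpair.2)) (by fun_prop)
  -- Residues `1` and `0` modulo `4` mark equations and their negations. Both sides are evaluated as
  -- rationals, so no search for the constant naming a value is needed.
  let c : ℕ × ℕ → ℕ := fun p => 
    bif (s p).1 && (t p).1 && ((p.2 % 4 == 1 && ratEq (s p).2 (t p).2) ||
      (p.2 % 4 == 0 && !ratEq (s p).2 (t p).2)) then 1 else 0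
  have hc : Computable c := by fun_prop
  obtain ⟨f, hf, hfc⟩ := exists_phi_eq (f := fun p => Part.some (c p)) hc.partrec
  refine ⟨f, hf, fun n => ?_⟩
  -- Keeping only first occurrences makes the listing injective, and this is decidable since only
  -- earlier indices are compared.
  let U : Set ℕ := {i | isNew E n i = true}
  have hbij : Function.Bijective
      (fun i : U => (⟨rat (E (n, i)), (hH n _).2 ⟨i, rfl⟩⟩ : H n)) := by
    constructor
    · rintro ⟨i, hi⟩ ⟨j, hj⟩ e
      have e' : rat (E (n, i)) = rat (E (n, j)) := congrArg Subtype.val e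
      have hi' := isNew_iff.1 hi
      have hj' := isNew_iff.1 hj
      rcases lt_trichotomy i j with h | h | h
      · exact absurd e' (hj' i h)
      · exact Subtype.ext h
      · exact absurd e'.symm (hi' j h)
    · rintro ⟨q, hq⟩
      classical
      have hex := (hH n q).1 hq
      refine ⟨⟨Nat.find hex, isNew_iff.2 fun j hj => ?_⟩, Subtype.ext (Nat.find_spec hex)⟩
      rw [Nat.find_spec hex]
      exact Nat.find_min hex hj
  let e : U ≃ H n := Equiv.ofBijective _ hbij
  have he : ∀ i : U, (e i : ℚ) = rat (E (n, i)) := fun i => rfl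
  let S : groupLang.Structure U := structureOf (e.symm 0) (fun a => e.symm (-e a))
    (fun a b => e.symm (e a + e b))
  have h1 : e (sOne U) = 0 := e.apply_symm_apply _
  have hi : ∀ a, e (sInv a) = -e a := fun a => e.apply_symm_apply _
  have hm : ∀ a b, e (sMul a b) = e a + e b := fun a b => e.apply_symm_apply _
  refine ⟨U, S, ⟨equivOfHom e h1 hi hm⟩, ?_⟩
  -- The computed flag and rational agree with the true value of the term in the copy.
  have key : ∀ t : groupLang.Term ℕ, (evalIn U t).map (fun a => (e a : ℚ)) =
      bif (evalAt E n t).1 then some (rat (evalAt E n t).2) else Option.none := by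
    intro t
    induction t using term_induction with
    | hvar i =>
      by_cases h : isNew E n i = true
      · rw [evalIn_var.2 (show i = (⟨i, h⟩ : U) from rfl)]
        simp [evalAt, h, he]
      · have h' : evalIn U (.var i) = Option.none := by
          rw [Option.eq_none_iff_forall_not_mem]
          intro a ha
          exact h (evalIn_var.1 ha ▸ a.2)
        simp [h', evalAt, h]
    | hone =>
      rw [evalIn_tOne, evalAt, realize_tOne]
      have : sOne (Bool × ℕ × ℕ × ℕ) = (true, 0, 0, 0) := rfl
      simp [this, h1, rat]
    | hinv t ih =>
      have h' : evalAt E n (tInv t) = ((evalAt E n t).1, (evalAt E n t).2.2.1, (evalAt E n t).2.1,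
          (evalAt E n t).2.2.2) := evalAt_tInv n t
      rw [evalIn_tInv, h', rat_neg]
      cases hv : evalIn U t <;> cases hw : (evalAt E n t).1 <;> simp [hv, hw] at ih ⊢
      rw [hi, ← ih]; rfl
    | hmul s t hs ht =>
      have h' : evalAt E n (tMul s t) = ((evalAt E n s).1 && (evalAt E n t).1,
          (evalAt E n s).2.1 * ((evalAt E n t).2.2.2 + 1) +
            (evalAt E n t).2.1 * ((evalAt E n s).2.2.2 + 1),
          (evalAt E n s).2.2.1 * ((evalAt E n t).2.2.2 + 1) +
            (evalAt E n t).2.2.1 * ((evalAt E n s).2.2.2 + 1),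
          ((evalAt E n s).2.2.2 + 1) * ((evalAt E n t).2.2.2 + 1) - 1) :=
        evalAt_tMul n s t
      rw [evalIn_tMul, h', rat_add]
      cases hv : evalIn U s <;> cases hw : (evalAt E n s).1 <;> simp [hv, hw] at hs ⊢
      cases hv' : evalIn U t <;> cases hw' : (evalAt E n t).1 <;> simp [hv', hw'] at ht ⊢
      rw [hm, ← hs, ← ht]; rfl
  have hdef : ∀ t : groupLang.Term ℕ, (evalAt E n t).1 = true →
      ∃ a, evalIn U t = some a ∧ (e a : ℚ) = rat (evalAt E n t).2 := by
    intro t h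
    have := key t
    rw [h, cond_true, Option.map_eq_some_iff] at this
    exact this
  have hundef : ∀ (t : groupLang.Term ℕ) a, evalIn U t = some a → (evalAt E n t).1 = true ∧
      (e a : ℚ) = rat (evalAt E n t).2 := by
    intro t a ha
    have := key t
    rw [ha] at this
    cases h : (evalAt E n t).1 <;> simp [h] at this
    exact ⟨rfl, this⟩
  have hmem : ∀ k, k ∈ diagram U ↔ c (n, k) = 1 := by
    intro k
    by_cases hk : 2 ≤ k % 4
    · have hc0 : c (n, k) = 0 := by simp [c, beq_false_of_ne (show k % 4 ≠ 1 by omega),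
          beq_false_of_ne (show k % 4 ≠ 0 by omega)]
      rw [hc0]
      simp only [zero_ne_one, iff_false]
      intro h
      have := (isDiagram_diagram U).literal k h
      omega
    · obtain ⟨⟨b, s', t'⟩, rfl⟩ := exists_code_eq (not_le.1 hk)
      rw [toQF_code_mem_diagram]
      have hcode := Literal.code_toQF (b, s', t')
      have e1 : (Literal.toQF (b, s', t')).code / 4 = Nat.pair (termCode s') (termCode t') := by
        rw [hcode]
        cases b <;> simp
        omega
      have e2 : (Literal.toQF (b, s', t')).code % 4 = bif b then 1 else 0 := by
        rw [hcode]; cases b <;> simp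
      have es : s (n, (Literal.toQF (b, s', t')).code) = evalAt E n s' := by
        simp only [s, e1, Nat.unpair_pair, termOfCode_termCode]
      have et : t (n, (Literal.toQF (b, s', t')).code) = evalAt E n t' := by
        simp only [t, e1, Nat.unpair_pair, termOfCode_termCode]
      have hcv : c (n, (Literal.toQF (b, s', t')).code) = 1 ↔ (evalAt E n s').1 = true ∧
          (evalAt E n t').1 = true ∧
          (b = true ↔ rat (evalAt E n s').2 = rat (evalAt E n t').2) := by
        simp only [c, es, et, e2, ← ratEq_iff]
        cases b <;> cases (evalAt E n s').1 <;> cases (evalAt E n t').1 <;>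
          cases ratEq (evalAt E n s').2 (evalAt E n t').2 <;> simp
      rw [hcv]
      constructor
      · rintro ⟨x, y, hx, hy, h⟩
        obtain ⟨g1, g2⟩ := hundef _ _ hx
        obtain ⟨g3, g4⟩ := hundef _ _ hy
        refine ⟨g1, g3, ?_⟩
        rw [← g2, ← g4, Subtype.coe_inj, e.apply_eq_iff_eq]
        exact h
      · rintro ⟨g1, g3, h⟩
        obtain ⟨x, hx, g2⟩ := hdef _ g1
        obtain ⟨y, hy, g4⟩ := hdef _ g3
        refine ⟨x, y, hx, hy, ?_⟩
        rw [← g2, ← g4, Subtype.coe_inj, e.apply_eq_iff_eq] at h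
        exact h
  have hc01 : ∀ p, c p = 0 ∨ c p = 1 := by
    intro p
    simp only [c]
    generalize (_ && _ : Bool) = b
    cases b <;> simp
  intro k
  rw [hfc, hmem]
  exact ⟨fun h => by rw [h], fun h => by rw [(hc01 _).resolve_right h]⟩

end Copies

/-! ### Subgroups of the rationals -/

section Subgroups

theorem int_mul_mem {R : AddSubgroup ℚ} (n : ℤ) {r : ℚ} (hr : r ∈ R) : (n : ℚ) * r ∈ R := by
  rw [← zsmul_eq_mul]
  exact R.zsmul_mem hr n

/-- Bézout: from `1 = m s + n t` follows `r / (m n) = s (r / n) + t (r / m)`. -/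
theorem div_mul_mem {R : AddSubgroup ℚ} {m n : ℕ} (h : m.Coprime n) (hm : m ≠ 0) (hn : n ≠ 0)
    {r : ℚ} (h1 : r / m ∈ R) (h2 : r / n ∈ R) : r / (m * n : ℕ) ∈ R := by
  have hb : (1 : ℚ) = m * (m.gcdA n : ℤ) + n * (m.gcdB n : ℤ) := by
    have := Nat.gcd_eq_gcd_ab m n
    rw [h.gcd_eq_one] at this
    exact_mod_cast this
  have hm' : (m : ℚ) ≠ 0 := by exact_mod_cast hm
  have hn' : (n : ℚ) ≠ 0 := by exact_mod_cast hn
  have e : r / (m * n : ℕ) = (m.gcdA n : ℤ) * (r / n) + (m.gcdB n : ℤ) * (r / m) := by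
    push_cast
    calc r / (m * n) = r * 1 / (m * n) := by rw [mul_one]
      _ = _ := by rw [hb]; field_simp
  rw [e]
  exact R.add_mem (int_mul_mem _ h2) (int_mul_mem _ h1)

/-- The elements of `R` that are divisible in `R` by the members of `B`. -/
def shrink (R : AddSubgroup ℚ) (B : Set ℕ) : AddSubgroup ℚ where
  carrier := {r | r ∈ R ∧ ∀ b ∈ B, r / b ∈ R}
  zero_mem' := ⟨R.zero_mem, fun b _ => by rw [zero_div]; exact R.zero_mem⟩
  add_mem' := fun hx hy => ⟨R.add_mem hx.1 hy.1, fun b hb => by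
    rw [add_div]; exact R.add_mem (hx.2 b hb) (hy.2 b hb)⟩
  neg_mem' := fun hx => ⟨R.neg_mem hx.1, fun b hb => by
    rw [neg_div]; exact R.neg_mem (hx.2 b hb)⟩

theorem mem_shrink {R : AddSubgroup ℚ} {B : Set ℕ} {r : ℚ} :
    r ∈ shrink R B ↔ r ∈ R ∧ ∀ b ∈ B, r / b ∈ R := Iff.rfl

/-- Distinct primes are coprime, so divisibility by each of them adds up to divisibility by their
product. -/
theorem mem_shrink_finset {R : AddSubgroup ℚ} {s : Finset ℕ} (hs : ∀ b ∈ s, b.Prime) {r : ℚ} :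
    r ∈ shrink R s ↔ r / (∏ b ∈ s, b : ℕ) ∈ R := by
  rw [mem_shrink]
  have hne : ∀ t ⊆ s, (∏ b ∈ t, b) ≠ 0 := fun t ht =>
    Finset.prod_ne_zero_iff.2 fun b hb => (hs b (ht hb)).ne_zero
  constructor
  · rintro ⟨h, hB⟩
    have : ∀ t ⊆ s, r / (∏ b ∈ t, b : ℕ) ∈ R := by
      intro t
      induction t using Finset.induction_on with
      | empty => intro _; simpa using h
      | insert b t hb ih =>
        intro ht
        have ht' := (Finset.subset_insert b t).trans ht
        have hbs := ht (Finset.mem_insert_self b t)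
        rw [Finset.prod_insert hb]
        refine div_mul_mem (Nat.Coprime.prod_right fun c hc => ?_) (hs b hbs).ne_zero (hne t ht')
          (hB b hbs) (ih ht')
        exact (Nat.coprime_primes (hs b hbs) (hs c (ht' hc))).2 (by rintro rfl; exact hb hc)
    exact this s subset_rfl
  · intro h
    have hdvd : ∀ m, m ∣ (∏ b ∈ s, b) → r / m ∈ R := by
      rintro m ⟨k, hk⟩
      have h0 : ((m * k : ℕ) : ℚ) ≠ 0 := by exact_mod_cast hk ▸ hne s subset_rfl
      push_cast at h0
      have e : r / m = ((k : ℕ) : ℤ) * (r / (∏ b ∈ s, b : ℕ)) := by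
        have hm : (m : ℚ) ≠ 0 := left_ne_zero_of_mul h0
        have hk' : (k : ℚ) ≠ 0 := right_ne_zero_of_mul h0
        rw [hk]
        push_cast
        field_simp
      rw [e]
      exact int_mul_mem _ h
    exact ⟨by simpa using hdvd 1 (one_dvd _), fun b hb => hdvd b (Finset.dvd_prod_of_mem _ hb)⟩

/-- Division by the product of `B` carries the subgroup onto `R`. -/
theorem nonempty_shrink_equiv {R : AddSubgroup ℚ} {B : Set ℕ} (hB : B.Finite)
    (hp : ∀ b ∈ B, b.Prime) : Nonempty (shrink R B ≃[groupLang] R) := by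
  lift B to Finset ℕ using hB
  have hc : ((∏ b ∈ B, b : ℕ) : ℚ) ≠ 0 := by
    exact_mod_cast Finset.prod_ne_zero_iff.2 fun b hb => (hp b hb).ne_zero
  have hmem : ∀ r, r ∈ shrink R B ↔ r / (∏ b ∈ B, b : ℕ) ∈ R := fun r => mem_shrink_finset hp
  generalize ((∏ b ∈ B, b : ℕ) : ℚ) = c at hc hmem
  refine ⟨equivOfHom
    ⟨fun r => ⟨r / c, (hmem r).1 r.2⟩,
      fun r => ⟨r * c, (hmem _).2 (by rw [mul_div_cancel_right₀ _ hc]; exact r.2)⟩,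
      fun r => Subtype.ext (div_mul_cancel₀ _ hc),
      fun r => Subtype.ext (mul_div_cancel_right₀ _ hc)⟩ ?_ ?_ ?_⟩
  · exact Subtype.ext (zero_div c)
  · exact fun a => Subtype.ext (neg_div c (a : ℚ))
  · exact fun a b => Subtype.ext (add_div (a : ℚ) b c)

/-- An isomorphism acts as multiplication by the image `q` of `1`. For a prime `b ∈ B` not dividing
the numerator of `q`, with `b ^ m` the last power whose inverse is in `R`, the image `q / b ^ m` is
divisible by `b` in `R`, which forces `1 / b ^ (m + 1)` into `R`. -/
theorem finite_of_shrink_equiv {R : AddSubgroup ℚ} (h1 : (1 : ℚ) ∈ R) {B : Set ℕ}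
    (hp : ∀ b ∈ B, b.Prime)
    (hinf : {p : ℕ | p.Prime ∧ ∀ k > 0, 1 / ((p ^ k : ℕ) : ℚ) ∈ R}.Finite)
    (f : R ≃[groupLang] shrink R B) : B.Finite := by
  by_contra hB
  let g : R →+ shrink R B := AddMonoidHom.mk' f fun a b => equiv_sMul f a b
  set q : ℚ := ((g ⟨1, h1⟩ : shrink R B) : ℚ) with hq
  have hq0 : q ≠ 0 := by
    intro h
    have h0 : g ⟨1, h1⟩ = g 0 := by
      rw [map_zero]; exact Subtype.ext h
    have := f.injective h0
    exact one_ne_zero (congrArg Subtype.val this)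
  -- Exceeding the nonzero numerator of `q` keeps `b` from dividing it, and infinitude of `B` leaves
  -- room to avoid the finitely many primes of infinite exponent.
  obtain ⟨b, ⟨hb, hbinf⟩, hbq⟩ := ((Set.Infinite.sdiff hB hinf).exists_gt q.num.natAbs)
  have hbp := hp b hb
  have hex : ∃ k, 1 / ((b ^ k : ℕ) : ℚ) ∉ R := by
    by_contra hcon
    push Not at hcon
    exact hbinf ⟨hbp, fun k _ => hcon k⟩
  classical
  obtain ⟨m, hm, hm'⟩ : ∃ m, 1 / ((b ^ m : ℕ) : ℚ) ∈ R ∧ 1 / ((b ^ (m + 1) : ℕ) : ℚ) ∉ R := by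
    have hs := Nat.find_spec hex
    obtain ⟨m, hm⟩ : ∃ m, Nat.find hex = m + 1 := by
      refine Nat.exists_eq_succ_of_ne_zero fun h0 => ?_
      rw [h0] at hs
      exact hs (by simpa using h1)
    refine ⟨m, ?_, hm ▸ hs⟩
    by_contra h
    have := Nat.find_le (h := hex) h
    omega
  have hbm : ((b ^ m : ℕ) : ℚ) ≠ 0 := by exact_mod_cast pow_ne_zero m hbp.ne_zero
  have hval : (g ⟨_, hm⟩ : ℚ) = q / (b ^ m : ℕ) := by
    have e : (b ^ m) • (⟨_, hm⟩ : R) = ⟨1, h1⟩ := Subtype.ext (by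
      change (b ^ m) • (1 / ((b ^ m : ℕ) : ℚ)) = 1
      rw [nsmul_eq_mul, mul_one_div_cancel hbm])
    have e' := congrArg (fun r => (g r : ℚ)) e
    simp only [map_nsmul] at e'
    rw [eq_div_iff hbm, mul_comm, ← nsmul_eq_mul]
    exact e'
  have hmem := (mem_shrink.1 (g ⟨_, hm⟩).2).2 b hb
  rw [hval] at hmem
  -- Multiplying by the denominator replaces `q` by its numerator, which is coprime to `b`.
  have hnum : (q.num : ℚ) / (b ^ (m + 1) : ℕ) ∈ R := by
    have := int_mul_mem (q.den : ℤ) hmem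
    convert this using 1
    have hd : (q.den : ℚ) * q = q.num := by rw [mul_comm]; exact Rat.mul_den_eq_num q
    rw [div_div, ← mul_div_assoc]
    push_cast
    rw [hd, pow_succ]
  have hcop : IsCoprime q.num ((b ^ (m + 1) : ℕ) : ℤ) := by
    rw [Int.isCoprime_iff_gcd_eq_one, Int.gcd_eq_natAbs, Int.natAbs_natCast]
    refine Nat.Coprime.pow_right _ (Nat.Coprime.symm ((Nat.Prime.coprime_iff_not_dvd hbp).2 ?_))
    intro hdvd
    exact absurd (Nat.le_of_dvd (Int.natAbs_pos.2 (Rat.num_ne_zero.2 hq0)) hdvd) (not_le.2 hbq)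
  obtain ⟨x, y, hxy⟩ := hcop
  refine hm' ?_
  have hb1 : ((b ^ (m + 1) : ℕ) : ℚ) ≠ 0 := by exact_mod_cast pow_ne_zero _ hbp.ne_zero
  have hxy' : (x : ℚ) * q.num + y * (b ^ (m + 1) : ℕ) = 1 := by exact_mod_cast hxy
  have e : 1 / ((b ^ (m + 1) : ℕ) : ℚ) = x * (q.num / (b ^ (m + 1) : ℕ)) + y * 1 := by
    rw [mul_one, ← hxy', add_div, mul_div_assoc, mul_div_cancel_right₀ _ hb1]
  rw [e]
  exact R.add_mem (int_mul_mem _ hnum) (int_mul_mem _ h1)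

/-- A prime of `B` larger than the coded denominator imposes no condition, so the infinitely many
requirements reduce to a bounded check. -/
theorem mem_shrink_rat {R : AddSubgroup ℚ} {B : Set ℕ} (hp : ∀ b ∈ B, b.Prime)
    (hB : ∀ b ∈ B, 1 / (b : ℚ) ∈ R) {t : ℕ × ℕ × ℕ} :
    rat t ∈ shrink R B ↔ rat t ∈ R ∧
      ∀ b < t.2.2 + 2, b ∉ B ∨ rat (t.1, t.2.1, (t.2.2 + 1) * b - 1) ∈ R := by
  have hdiv : ∀ b ∈ B, rat (t.1, t.2.1, (t.2.2 + 1) * b - 1) = rat t / b := by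
    intro b hb
    have h : (((t.2.2 + 1) * b - 1 : ℕ) : ℚ) + 1 = (t.2.2 + 1) * b := by
      rw [← Nat.cast_add_one, Nat.sub_add_cancel (Nat.mul_pos (Nat.succ_pos _) (hp b hb).pos)]
      push_cast; rfl
    simp only [rat, h, div_div]
  rw [mem_shrink]
  refine and_congr_right fun ht => ⟨fun h b _ => ?_, fun h b hb => ?_⟩
  · by_cases hb : b ∈ B
    · exact .inr (hdiv b hb ▸ h b hb)
    · exact .inl hb
  · by_cases hlt : b < t.2.2 + 2
    · exact hdiv b hb ▸ (h b hlt).resolve_left (not_not.2 hb)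
    · have hcop : b.Coprime (t.2.2 + 1) :=
        (Nat.Prime.coprime_iff_not_dvd (hp b hb)).2 fun hdvd => by
          have := Nat.le_of_dvd (Nat.succ_pos _) hdvd
          omega
      -- With `c` the coded denominator and `1 = b s + c s'`, `rat t / b` equals `s (rat t)` plus
      -- the integer `s' c (rat t)` times `1 / b`.
      have hbz : (1 : ℚ) = b * (b.gcdA (t.2.2 + 1) : ℤ) + (t.2.2 + 1) * (b.gcdB (t.2.2 + 1) : ℤ) := by
        have := Nat.gcd_eq_gcd_ab b (t.2.2 + 1)
        rw [hcop.gcd_eq_one] at this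
        exact_mod_cast this
      have hb0 : (b : ℚ) ≠ 0 := by exact_mod_cast (hp b hb).ne_zero
      have hc0 : (t.2.2 : ℚ) + 1 ≠ 0 := by positivity
      have hr : (t.2.2 + 1) * rat t = t.1 - t.2.1 := by
        rw [rat, mul_div_cancel₀ _ hc0]
      have e : rat t / b = (b.gcdA (t.2.2 + 1) : ℤ) * rat t +
          ((b.gcdB (t.2.2 + 1) * ((t.1 : ℤ) - t.2.1) : ℤ) : ℚ) * (1 / b) := by
        push_cast
        rw [← hr]
        calc rat t / b = rat t * (b * (b.gcdA (t.2.2 + 1) : ℤ) +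
              (t.2.2 + 1) * (b.gcdB (t.2.2 + 1) : ℤ)) / b := by rw [← hbz, mul_one]
          _ = _ := by field_simp
      rw [e]
      exact R.add_mem (int_mul_mem _ ht) (int_mul_mem _ (hB b hb))

end Subgroups

/-! ### The reduction -/

theorem exists_computable_prime {α : Type*} [Primcodable α] {f : α → ℕ} (hf : Computable f) :
    ∃ g : α → Bool, Computable g ∧ ∀ a, (f a).Prime ↔ g a = true := by
  refine ⟨fun a => Nat.ble 2 (f a) && ballBool (fun m => (m == 1) || !(f a % m == 0)) (f a), ?_,
    fun a => ?_⟩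
  · have : Computable fun a => ballBool (fun m => (m == 1) || !(f a % m == 0)) (f a) :=
      computable_ballBool (by fun_prop) hf
    fun_prop
  · rw [Nat.prime_def_lt, Bool.and_eq_true, Nat.ble_eq, ballBool_eq_true]
    refine and_congr_right fun _ => forall_congr' fun m => imp_congr_right fun _ => ?_
    rw [Nat.dvd_iff_mod_eq_zero]
    by_cases hm : m = 1 <;> simp [hm]

theorem isSigma01_rat_mem {R : AddSubgroup ℚ} {E : ℕ → ℕ × ℕ × ℕ} (hE : Computable E)
    (hER : ∀ q, q ∈ R ↔ ∃ n, rat (E n) = q) : IsSigma01 fun t => rat t ∈ R := by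
  refine IsSigma01.of_iff (P := fun t => ∃ n, ratEq (E n) t = true)
    (.ex (.of_bool (by fun_prop))) fun t => ?_
  simp only [hER, ratEq_iff]

/-- A computable sequence of primes that divide `1` in `R` and exceed their indices. -/
theorem exists_primes {R : AddSubgroup ℚ} {E : ℕ → ℕ × ℕ × ℕ} (hE : Computable E)
    (hER : ∀ q, q ∈ R ↔ ∃ n, rat (E n) = q)
    (hfin : {p : ℕ | p.Prime ∧ 1 / (p : ℚ) ∈ R}.Infinite) :
    ∃ q : ℕ → ℕ, Computable q ∧ ∀ j, (q j).Prime ∧ 1 / (q j : ℚ) ∈ R ∧ j < q j := by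
  have hS : IsSigma01 fun p : Unit × ℕ => p.2.Prime ∧ rat (1, 0, p.2 - 1) ∈ R := by
    obtain ⟨g, hg, hgp⟩ := exists_computable_prime (α := Unit × ℕ) Computable.snd
    exact (IsSigma01.of_computable hg hgp).and ((isSigma01_rat_mem hE hER).comp (by fun_prop))
  have hiff : ∀ p : ℕ, (p.Prime ∧ rat (1, 0, p - 1) ∈ R) ↔ (p.Prime ∧ 1 / (p : ℚ) ∈ R) := by
    refine fun p => and_congr_right fun hp => ?_
    have : rat (1, 0, p - 1) = 1 / (p : ℚ) := by
      have h : ((p - 1 : ℕ) : ℚ) + 1 = p := by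
        rw [← Nat.cast_add_one, Nat.sub_add_cancel hp.pos]
      simp [rat, h]
    rw [this]
  obtain ⟨p₀, hp₀⟩ := hfin.nonempty
  obtain ⟨h, hh, hhS⟩ := hS.exists_enum p₀ fun _ => (hiff _).2 hp₀
  have hex : ∀ j : ℕ, ∃ i, j < h ((), i) := by
    intro j
    obtain ⟨p, hp, hjp⟩ := hfin.exists_gt j
    obtain ⟨i, hi⟩ := (hhS () p).1 ((hiff p).2 hp)
    exact ⟨i, hi.symm ▸ hjp⟩
  -- The search for a prime above `j` terminates because the listed set is infinite.
  have hfind : Computable fun j => Nat.find (hex j) := by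
    refine Computable.find (P := fun j i => j < h ((), i)) ?_ hex
    exact computablePred_iff.2 ⟨fun p => Nat.ble (p.1 + 1) (h ((), p.2)), by fun_prop, fun p => by
      rw [Nat.ble_eq]; rfl⟩
  refine ⟨fun j => h ((), Nat.find (hex j)), by fun_prop, fun j => ?_⟩
  have := (hiff _).1 ((hhS () _).2 ⟨_, rfl⟩ : (h ((), Nat.find (hex j))).Prime ∧ _)
  exact ⟨this.1, this.2, Nat.find_spec (hex j)⟩

theorem reducible_indexSet {A : Type} [groupLang.Structure A] {R : AddSubgroup ℚ}
    {E : ℕ → ℕ × ℕ × ℕ} (hE : Computable E) (h1 : (1 : ℚ) ∈ R)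
    (hER : ∀ q, q ∈ R ↔ ∃ n, rat (E n) = q) (hRA : Nonempty (R ≃[groupLang] A))
    (h : ∀ (M : Type) [groupLang.Structure M],
      Nonempty (M ≃[groupLang] A) ↔ ∃ x : M, IsModel E x)
    (hfin : {p : ℕ | p.Prime ∧ 1 / (p : ℚ) ∈ R}.Infinite)
    (hinf : {p : ℕ | p.Prime ∧ ∀ k > 0, 1 / ((p ^ k : ℕ) : ℚ) ∈ R}.Finite)
    {S : Set ℕ} (hS : IsSigma03 S) :
    ManyOneReducible (fun n => n ∈ S) (fun n => n ∈ indexSet A) := by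
  obtain ⟨V, hV, hSV⟩ := exists_cofinite_of_isSigma03 hS
  obtain ⟨q, hq, hqR⟩ := exists_primes hE hER hfin
  let B : ℕ → Set ℕ := fun n => q '' {j | ¬ V (n, j)}
  have hBp : ∀ n, ∀ b ∈ B n, b.Prime := by
    rintro n _ ⟨j, -, rfl⟩; exact (hqR j).1
  have hBR : ∀ n, ∀ b ∈ B n, 1 / (b : ℚ) ∈ R := by
    rintro n _ ⟨j, -, rfl⟩; exact (hqR j).2.1
  have hBfin : ∀ n, (B n).Finite ↔ n ∈ S := by
    intro n
    rw [hSV]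
    constructor
    · intro hB
      obtain ⟨m, hm⟩ := hB.bddAbove
      refine (Set.finite_Iio m).subset fun j hj => ?_
      exact (hqR j).2.2.trans_le (hm ⟨j, hj, rfl⟩)
    · exact fun hf => hf.image q
  -- Since `j < q j`, only `j < p` can put `p` into `B n`, which leaves a bounded quantifier over a
  -- `Σ⁰₁` condition.
  have hBS : IsSigma01 fun p : ℕ × ℕ => p.2 ∉ B p.1 := by
    refine IsSigma01.of_iff
      (P := fun p : ℕ × ℕ => ∀ j < p.2, (!(q j == p.2)) = true ∨ V (p.1, j))
      (.ball (.or (.of_bool (by fun_prop)) (hV.comp (by fun_prop))) (by fun_prop)) fun p => ?_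
    constructor
    · intro hp j _
      by_contra hcon
      simp only [Bool.not_eq_true', beq_eq_false_iff_ne, not_or, ne_eq, not_not] at hcon
      exact hp ⟨j, hcon.2, hcon.1⟩
    · rintro hp ⟨j, hj, hjp⟩
      have hlt : j < p.2 := hjp ▸ (hqR j).2.2
      exact (hp j hlt).elim (fun h => by simp [hjp] at h) hj
  have hRS := isSigma01_rat_mem hE hER
  have hHS : IsSigma01 fun p : ℕ × ℕ × ℕ × ℕ => rat p.2 ∈ shrink R (B p.1) := by
    refine IsSigma01.of_iff (P := fun p : ℕ × ℕ × ℕ × ℕ => rat p.2 ∈ R ∧ ∀ b < p.2.2.2 + 2,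
      b ∉ B p.1 ∨ rat (p.2.1, p.2.2.1, (p.2.2.2 + 1) * b - 1) ∈ R) ?_
      fun p => mem_shrink_rat (hBp p.1) (hBR p.1)
    exact (hRS.comp (by fun_prop)).and (.ball (.or
      (hBS.comp (g := fun r : (ℕ × ℕ × ℕ × ℕ) × ℕ => (r.1.1, r.2)) (by fun_prop))
      (hRS.comp (g := fun r : (ℕ × ℕ × ℕ × ℕ) × ℕ =>
        (r.1.2.1, r.1.2.2.1, (r.1.2.2.2 + 1) * r.2 - 1)) (by fun_prop))) (by fun_prop))
  -- The triple `(0, 0, 0)` codes `0`, which lies in every subgroup and serves as the default value.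
  obtain ⟨E', hE', hEH⟩ := hHS.exists_enum (0, 0, 0) fun n => by
    simp [rat]
  obtain ⟨f, hf, hfU⟩ := exists_computable_copies hE' (fun n => shrink R (B n)) fun n r => by
    constructor
    · intro hr
      obtain ⟨t, rfl⟩ := exists_rat_eq r
      obtain ⟨i, hi⟩ := (hEH n t).1 hr
      exact ⟨i, by rw [hi]⟩
    · rintro ⟨i, rfl⟩
      exact (hEH n _).2 ⟨i, rfl⟩
  refine ⟨f, hf, fun n => ?_⟩
  change n ∈ S ↔ f n ∈ indexSet A
  obtain ⟨e⟩ := hRA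
  obtain ⟨U, hU, ⟨g⟩, hφ⟩ := hfU n
  constructor
  · intro hn
    obtain ⟨g'⟩ := nonempty_shrink_equiv (R := R) ((hBfin n).2 hn) (hBp n)
    refine ⟨U, hU, ⟨e.comp (g'.comp g)⟩, fun k => ?_⟩
    split_ifs with hk
    · exact (hφ k).1 hk
    · exact (hφ k).2 hk
  · rintro ⟨U', hU', hA, hφ'⟩
    -- `U` and `U'` may be presented differently, but one function decides both diagrams. The axioms
    -- depend only on the diagram, so they pass from `U'` to `U`.
    have hD : diagram U = diagram U' := by
      ext k
      have h2 := hφ' k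
      by_cases hk : k ∈ diagram U <;> by_cases hk' : k ∈ diagram U' <;> simp only [hk, hk']
      · rw [(hφ k).1 hk, if_neg hk'] at h2
        simp at h2
      · rw [(hφ k).2 hk, if_pos hk'] at h2
        simp at h2
    obtain ⟨x, hx⟩ := (h U').1 hA
    have hx' : ModelIn E (diagram U') x := modelIn_diagram.2 ⟨x.2, hx⟩
    rw [← hD] at hx'
    obtain ⟨hxU, hm⟩ := modelIn_diagram.1 hx'
    obtain ⟨g'⟩ := (h U).2 ⟨_, hm⟩
    exact (hBfin n).1 (finite_of_shrink_equiv h1 (hBp n) hinf (g.comp (g'.symm.comp e)))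

/-! ### Normalization -/

/-- The subgroup of the `q` with `q u` in `G`, which is isomorphic to `G` and contains `1`. -/
def normalize (G : AddSubgroup ℚ) (u : G) : AddSubgroup ℚ := G.comap (AddMonoidHom.mulRight (u : ℚ))

theorem mem_normalize {G : AddSubgroup ℚ} {u : G} {q : ℚ} : q ∈ normalize G u ↔ q * u ∈ G := Iff.rfl

theorem nonempty_normalize_equiv {G : AddSubgroup ℚ} {u : G} (hu : u ≠ 0) :
    Nonempty (normalize G u ≃[groupLang] G) := by
  have hu' : (u : ℚ) ≠ 0 := fun h => hu (Subtype.ext h)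
  refine ⟨equivOfHom
    ⟨fun q => ⟨q * u, q.2⟩,
      fun y => ⟨y / u, mem_normalize.2 (by rw [div_mul_cancel₀ _ hu']; exact y.2)⟩,
      fun q => Subtype.ext (mul_div_cancel_right₀ _ hu'),
      fun y => Subtype.ext (div_mul_cancel₀ _ hu')⟩ ?_ ?_ ?_⟩
  · exact Subtype.ext (zero_mul (u : ℚ))
  · exact fun a => Subtype.ext (neg_mul (a : ℚ) u)
  · exact fun a b => Subtype.ext (add_mul (a : ℚ) b u)

theorem dividesIn_iff {G : AddSubgroup ℚ} {u : G} {m : ℕ} (hm : m ≠ 0) :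
    DividesIn G m u ↔ 1 / (m : ℚ) ∈ normalize G u := by
  have hm' : (m : ℚ) ≠ 0 := by exact_mod_cast hm
  rw [mem_normalize]
  constructor
  · rintro ⟨y, rfl⟩
    have : 1 / (m : ℚ) * ((m • y : G) : ℚ) = y := by
      rw [AddSubgroup.coe_nsmul, nsmul_eq_mul, ← mul_assoc, one_div_mul_cancel hm', one_mul]
    rw [this]
    exact y.2
  · intro h
    refine ⟨⟨_, h⟩, Subtype.ext ?_⟩
    rw [AddSubgroup.coe_nsmul, nsmul_eq_mul, ← mul_assoc, mul_one_div_cancel hm', one_mul]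

/-- A computable enumeration of `normalize G u`, for a group with a computable copy. -/
theorem exists_enum_normalize {G : AddSubgroup ℚ} (hG : HasComputableCopy G) (u : G) :
    ∃ E : ℕ → ℕ × ℕ × ℕ, Computable E ∧ ∀ q, q ∈ normalize G u ↔ ∃ n, rat (E n) = q := by
  obtain ⟨U, hU, ⟨f⟩, hD⟩ := hG
  obtain ⟨d, hd, hdD⟩ := computablePred_iff.1 hD
  let x : U := f.symm u
  let l : ℕ × ℕ × ℕ → U → Literal U := fun t y =>
    (true, tMul (tPow (t.2.2 + 1) (.var y)) (tPow t.2.1 (.var x)), tPow t.1 (.var x))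
  -- The literal `l t y` says that `y` is `rat t` times the element corresponding to `u`.
  have hl : ∀ t y, (l t y).Holds id ↔ rat t * u = f y := by
    intro t y
    rw [← holds_equiv f, Literal.Holds, if_pos rfl]
    simp only [l, realize_tMul, realize_tPow, Language.Term.realize_var, Function.comp_apply, id,
      sPow_eq, x, Language.Equiv.apply_symm_apply]
    rw [← Subtype.coe_inj]
    change (t.2.2 + 1) • (f y : ℚ) + t.2.1 • (u : ℚ) = t.1 • (u : ℚ) ↔ _
    have hc : (t.2.2 : ℚ) + 1 ≠ 0 := by positivity
    simp only [nsmul_eq_mul, rat]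
    push_cast
    rw [div_mul_eq_mul_div, div_eq_iff hc]
    constructor <;> intro h <;> linarith
  have hS : IsSigma01 fun p : Unit × ℕ × ℕ × ℕ => rat p.2 ∈ normalize G u := by
    -- Membership is confirmed by finding a constant of the copy for which the decidable diagram
    -- contains this equation.
    refine IsSigma01.of_iff (P := fun p : Unit × ℕ × ℕ × ℕ => ∃ n : ℕ,
      (d (eqCode (.var n) (.var n)) && d (eqCode (tMul (tPow (p.2.2.2 + 1) (.var n))
        (tPow p.2.2.1 (.var x))) (tPow p.2.1 (.var x)))) = true)
      (.ex (.of_bool (by fun_prop))) fun p => ?_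
    have hcode : ∀ y : U, eqCode (tMul (tPow (p.2.2.2 + 1) (.var (y : ℕ)))
        (tPow p.2.2.1 (.var (x : ℕ)))) (tPow p.2.1 (.var (x : ℕ))) =
          ((l p.2 y).relabel Subtype.val).toQF.code := by
      intro y
      simp only [l, Literal.relabel, relabel_tMul, relabel_tPow, eqCode, Language.Term.relabel]
    simp only [Bool.and_eq_true, ← hdD, mem_iff_eqCode_mem_diagram]
    rw [mem_normalize]
    constructor
    · intro h
      refine ⟨f.symm ⟨_, h⟩, Subtype.prop _, ?_⟩
      rw [hcode, Literal.code_mem_diagram_iff, hl, Language.Equiv.apply_symm_apply]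
    · rintro ⟨n, hn, h⟩
      rw [hcode ⟨n, hn⟩, Literal.code_mem_diagram_iff, hl] at h
      rw [h]
      exact Subtype.prop _
  obtain ⟨E, hE, hEn⟩ := hS.exists_enum (0, 0, 0) fun _ => by simp [rat]
  refine ⟨fun n => E ((), n), by fun_prop, fun q => ?_⟩
  obtain ⟨t, rfl⟩ := exists_rat_eq q
  constructor
  · intro h
    obtain ⟨n, hn⟩ := (hEn () t).1 h
    exact ⟨n, congrArg rat hn⟩
  · rintro ⟨n, hn⟩
    rw [← hn]
    exact (hEn () _).2 ⟨n, rfl⟩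

end ScottQ

/-! ### The main theorem -/

theorem mainTheorem4 (G : AddSubgroup ℚ) (hG : ScottQ.HasComputableCopy G)
    (u : G) (hu : u ≠ 0)
    (h0 : (ScottQ.PZero G u).Infinite)
    (hfin : (ScottQ.PFin G u).Infinite)
    (hinf : (ScottQ.PInf G u).Finite) :
    (∃ φ : ScottQ.InfFormula, ScottQ.IsComputableSigma 3 φ ∧ φ.IsScottSentence G) ∧
      ScottQ.IsMCompleteSigma03 (ScottQ.indexSet G) := by
  obtain ⟨E, hE, hER⟩ := ScottQ.exists_enum_normalize hG u
  have h1 : (1 : ℚ) ∈ ScottQ.normalize G u := by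
    rw [ScottQ.mem_normalize, one_mul]; exact u.2
  have hRG := ScottQ.nonempty_normalize_equiv hu
  have h : ∀ (M : Type) [ScottQ.groupLang.Structure M],
      Nonempty (FirstOrder.Language.Equiv ScottQ.groupLang M G) ↔ ∃ x : M, ScottQ.IsModel E x := by
    intro M _
    rw [← ScottQ.nonempty_equiv_iff h1 hER]
    obtain ⟨e⟩ := hRG
    exact ⟨fun ⟨f⟩ => ⟨e.symm.comp f⟩, fun ⟨f⟩ => ⟨e.comp f⟩⟩
  refine ⟨ScottQ.exists_scottSentence hE h, ScottQ.isSigma03_indexSet hE h, fun S hS =>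
    ScottQ.reducible_indexSet hE h1 hER hRG h (hfin.mono ?_) (hinf.subset ?_) hS⟩
  · rintro p ⟨hp, k, hk, hd, -⟩
    refine ⟨hp, (ScottQ.dividesIn_iff hp.ne_zero).1 ?_⟩
    obtain ⟨y, hy⟩ := hd
    -- From `p ^ k • y = u` with `k > 0`, one factor `p` is split off.
    refine ⟨p ^ (k - 1) • y, ?_⟩
    rw [← mul_smul, ← pow_succ', Nat.sub_add_cancel hk, hy]
  · rintro p ⟨hp, hk⟩
    exact ⟨hp, fun k hk0 => (ScottQ.dividesIn_iff (pow_ne_zero k hp.ne_zero)).2 (hk k hk0)⟩
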